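/- Let $n\ge 1$ and let $H:\mathbb{R}^n\to\mathbb{R}$ be convex with $H(0)=\min_{\mathbb{R}^n}H=0$ and $H^{-1}(0)=\{0\}$. Let $U\subset\mathbb{R}^n$ be an unbounded open set whose boundary $\partial U$ is nonempty and compact. Write $V\ll U$ if $V$ is open and $\overline V$ is a compact subset of $U$. Let $\mathrm{Lip}_{\mathrm{loc}}(U)$ be the set of functions $w:U\to\mathbb{R}$ that are Lipschitz continuous on every $V\ll U$, and for $w\in\mathrm{Lip}_{\mathrm{loc}}(V)$ put $\|H(Dw)\|_{L^\infty(V)}:=\operatorname{ess\,sup}_{x\in V}H(Dw(x))$. A function $u\in\mathrm{Lip}_{\mathrm{loc}}(U)$ is called absolutely subminimizing (respectively, absolutely superminimizing) for $H$ in $U$ if $$\|H(Du)\|_{L^\infty(V)}\le\|H(Dw)\|_{L^\infty(V)}$$ whenever $V\ll U$ and $w\in\mathrm{Lip}_{\mathrm{loc}}(V)\cap C(\overline V)$ satisfy $w=u$ on $\partial V$ and $w\le u$ (respectively, $w\ge u$) in $V$. Let $u,v\in C(\overline U)$ be bounded, let $u$ be absolutely subminimizing for $H$ in $U$, and let $v$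 be absolutely superminimizing for $H$ in $U$. Then $$u(x)-v(x)\le\max_{y\in\partial U}\bigl(u(y)-v(y)\bigr)\qquad\text{for every }x\in U.$$ -/

import Mathlib

open MeasureTheory Set

namespace ExteriorComparison

/-- The standing assumptions on the Hamiltonian `H : ℝⁿ → ℝ`: it is convex,
`H 0 = min H = 0`, and its zero level set is bounded with empty interior. -/
structure IsHamiltonian {n : ℕ} (H : EuclideanSpace ℝ (Fin n) → ℝ) : Prop where
  convex : ConvexOn ℝ univ H
  map_zero : H 0 = 0
  nonneg : ∀ p, 0 ≤ H p
  bounded_zeroSet : Bornology.IsBounded (H ⁻¹' {0})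
  interior_zeroSet : interior (H ⁻¹' {0}) = ∅

/-- `V ≪ U`, for an open set `V`: the closure of `V` is a compact subset of `U`. -/
structure CompactlyInside {n : ℕ} (V U : Set (EuclideanSpace ℝ (Fin n))) : Prop where
  isOpen : IsOpen V
  isCompact_closure : IsCompact (closure V)
  closure_subset : closure V ⊆ U

/-- `v ∈ Lip_loc(U)`: `v` is Lipschitz continuous on every open `V ≪ U`.
Only the values of `v` on `U` matter. -/
def LipLoc {n : ℕ} (v : EuclideanSpace ℝ (Fin n) → ℝ)
    (U : Set (EuclideanSpace ℝ (Fin n))) : Prop :=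
  ∀ V, CompactlyInside V U → ∃ K : NNReal, LipschitzOnWith K v V

/-- `‖H(Dv)‖_{L^∞(V)} = ess sup_{x ∈ V} H(Dv(x))` with respect to Lebesgue measure, for
`v ∈ Lip_loc(V)` with `V` open; by Rademacher's theorem the gradient exists at almost every
point of `V`. -/
noncomputable def supHD {n : ℕ} (H : EuclideanSpace ℝ (Fin n) → ℝ)
    (v : EuclideanSpace ℝ (Fin n) → ℝ) (V : Set (EuclideanSpace ℝ (Fin n))) : EReal :=
  essSup (fun x => ((H (gradient v x) : ℝ) : EReal)) (volume.restrict V)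

/-- `u` is absolutely subminimizing for `H` in `U`. -/
def AbsSubminimizing {n : ℕ} (H : EuclideanSpace ℝ (Fin n) → ℝ)
    (u : EuclideanSpace ℝ (Fin n) → ℝ) (U : Set (EuclideanSpace ℝ (Fin n))) : Prop :=
  LipLoc u U ∧
    ∀ (V : Set (EuclideanSpace ℝ (Fin n))) (v : EuclideanSpace ℝ (Fin n) → ℝ),
      CompactlyInside V U → LipLoc v V → ContinuousOn v (closure V) →
      (∀ x ∈ frontier V, v x = u x) → (∀ x ∈ V, v x ≤ u x) →
      supHD H u V ≤ supHD H v V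

/-- `u` is absolutely superminimizing for `H` in `U`. -/
def AbsSuperminimizing {n : ℕ} (H : EuclideanSpace ℝ (Fin n) → ℝ)
    (u : EuclideanSpace ℝ (Fin n) → ℝ) (U : Set (EuclideanSpace ℝ (Fin n))) : Prop :=
  LipLoc u U ∧
    ∀ (V : Set (EuclideanSpace ℝ (Fin n))) (v : EuclideanSpace ℝ (Fin n) → ℝ),
      CompactlyInside V U → LipLoc v V → ContinuousOn v (closure V) →
      (∀ x ∈ frontier V, v x = u x) → (∀ x ∈ V, u x ≤ v x) →
      supHD H u V ≤ supHD H v V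

end ExteriorComparison

/-! Comparison with cones reduces the problem to a discrete one. The support function `cone H k` of
`{H ≤ k}` has gradients of level at most `k`. If a subminimizer `u` exceeded `u x₀ + cone H k (· -
x₀)` inside `V` but not on its boundary, testing minimality with this cone on the set of excess
would give `H(Du) ≤ k` there; integrating along the segment towards `x₀` up to its exit from that
set gives a contradiction (`AbsSubminimizing.coneComparison`).

Let `L` be the conjugate of `H`, truncated (`lag`), and let `Tᵗu(x)` be the local maximum over `y`
of `u(y) - t L((y - x)/t)`. Cone comparison yields the convexity criterion `2 Tᵗu ≤ u + T²ᵗu`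
(`ConeComparison.exists_two_mul_sub_stepCost_le`). Since two steps of time `t` cost at least one
step of time `2t`, with equality at midpoints, it follows that `w = Tᵗu` has an attained upward
slope which is at least its downward slope (`ConeComparison.discreteSub`). The reflection `-v`, `p ↦
H(-p)` gives the reversed inequality for the superminimizer.

The supremum of the difference need not be attained, so `discrete_comparison` does not work at a
maximum point. It replaces `w` by the best value of a chain ending where the slope is at least `δ`
or outside `Y`, with an extra fee `δ` per step. The new function has slope at least `δ` on all of
`Y`. It loses little at a given point, because `H > 0` off the origin makes `L` sublinear at `0`, so
fine chains are almost free. From a near-maximum of the difference, a steepest step leads to another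
near-maximum and raises the patched function by almost `δ`; repetition contradicts boundedness.
Compactness of the boundary controls the difference near it. -/

namespace ExteriorComparison

/-! ### Discrete comparison by patching -/

/-- The values of chains from a point to the set `F`: a chain may stop in `F`, where it collects
`u`, and it pays `c x y + δ` for each step from `x` to `y`. -/
inductive ChainValue {α : Type*} (N : α → α → Prop) (c : α → α → ℝ) (δ : ℝ) (u : α → ℝ)
    (F : Set α) : α → ℝ → Prop
  | base {x : α} (hx : x ∈ F) : ChainValue N c δ u F x (u x)
  | step {x y : α} {r : ℝ} (hx : x ∉ F) (hN : N x y) (h : ChainValue N c δ u F y r) :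
      ChainValue N c δ u F x (r - c x y - δ)

/-- The best value of a chain from `x` to `F`. -/
noncomputable def patch {α : Type*} (N : α → α → Prop) (c : α → α → ℝ) (δ : ℝ) (u : α → ℝ)
    (F : Set α) (x : α) : ℝ :=
  sSup {r | ChainValue N c δ u F x r}

/-- A discrete form of the subsolution property on `Y`: the upward slope of `u`, attained at some
neighbour, is at least its downward slope. -/
def DiscreteSub {α : Type*} (N : α → α → Prop) (c : α → α → ℝ) (u : α → ℝ) (Y : Set α) : Prop :=
  ∀ x ∈ Y, ∃ y, N x y ∧ (∀ y', N x y' → u y' - c x y' ≤ u y - c x y) ∧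
    ∀ z, N z x → 2 * u x ≤ u y - c x y + u z + c z x

section Patch

variable {α : Type*} {N : α → α → Prop} {c : α → α → ℝ} {u : α → ℝ} {Y : Set α} {δ : ℝ}
  {F : Set α}

/-- Induction along the chain: off `F` a step gains at most the slope `s`, which is less than the
fee `δ`. -/
theorem ChainValue.le {s : α → ℝ} (hs : ∀ x ∉ F, ∀ y, N x y → u y - c x y ≤ u x + s x)
    (hF : ∀ x ∉ F, s x < δ) {x : α} {r : ℝ} (h : ChainValue N c δ u F x r) : r ≤ u x := by
  induction h with
  | base hx => exact le_rfl
  | step hx hN h ih => linarith [hs _ hx _ hN, hF _ hx]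

theorem ChainValue.eq_of_mem {x : α} {r : ℝ} (h : ChainValue N c δ u F x r) (hx : x ∈ F) :
    r = u x := by
  cases h with
  | base _ => rfl
  | step hx' _ _ => exact absurd hx hx'

theorem patch_of_mem {x : α} (hx : x ∈ F) : patch N c δ u F x = u x := by
  have : {r | ChainValue N c δ u F x r} = {u x} := by
    ext r
    exact ⟨fun h => h.eq_of_mem hx, fun h => by rw [mem_singleton_iff.1 h]; exact .base hx⟩
  rw [patch, this, csSup_singleton]

/-- Discrete comparison principle with possibly unattained suprema. -/
theorem discrete_comparison {v : α → ℝ} {m B : ℝ} (hc : ∀ x y, 0 ≤ c x y)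
    (hu : DiscreteSub N c u Y)
    (hv : ∀ x ∈ Y, ∃ z, N z x ∧ ∀ y, N x y → v y - c x y + v z + c z x ≤ 2 * v x)
    (huB : ∀ x, u x ≤ B) (hvB : ∀ x, -B ≤ v x) (hm : ∀ x ∉ Y, u x - v x ≤ m)
    (hchain : ∀ x, ∀ η > 0, ∃ (k : ℕ) (γ : ℕ → α), γ 0 = x ∧ γ k ∉ Y ∧
      (∀ i < k, N (γ i) (γ (i + 1)) ∧ N (γ (i + 1)) (γ i)) ∧
      ∑ i ∈ Finset.range k, (c (γ i) (γ (i + 1)) + c (γ (i + 1)) (γ i)) ≤ η)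
    (x : α) : u x - v x ≤ m := by
  classical
  by_contra! hx
  -- the slope of `u`
  choose! p hpN hpmax hpslope using hu
  set s : α → ℝ := fun x => u (p x) - c x (p x) - u x with hs
  set g : ℝ := u x - v x - m with hg
  have hgpos : 0 < g := by linarith
  obtain ⟨k, γ, hγ0, hγk, hγN, hγsum⟩ := hchain x (g / 4) (by positivity)
  -- Patching along `γ` loses `2 * k * δ` and the costs in both directions, in total at most half of
  -- the gap `g`.
  obtain ⟨δ, hδ, hδk⟩ : ∃ δ : ℝ, 0 < δ ∧ 2 * k * δ ≤ g / 4 := by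
    refine ⟨g / (8 * (k + 1)), by positivity, ?_⟩
    rw [mul_div_assoc', div_le_div_iff₀ (by positivity) (by norm_num)]
    nlinarith
  -- Points outside `Y` are targets too, so a chain stops as soon as it leaves `Y`.
  set F : Set α := {x | x ∈ Y → δ ≤ s x} with hFdef
  have hFn : ∀ x, x ∉ F → x ∈ Y ∧ s x < δ := by
    intro x hx
    simpa [hFdef] using hx
  have hFY : ∀ x, x ∉ Y → x ∈ F := fun x hx h => absurd h hx
  set w := patch N c δ u F with hw
  -- any chain leads to `F` without losing more than its cost
  have hreach : ∀ (k : ℕ) (γ : ℕ → α), γ k ∉ Y →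
      (∀ i < k, N (γ i) (γ (i + 1)) ∧ N (γ (i + 1)) (γ i)) →
      ∃ r, ChainValue N c δ u F (γ 0) r ∧ u (γ 0) - 2 * k * δ -
        ∑ i ∈ Finset.range k, (c (γ i) (γ (i + 1)) + c (γ (i + 1)) (γ i)) ≤ r := by
    intro k
    induction k with
    | zero =>
      intro γ h0 _
      exact ⟨u (γ 0), .base (hFY _ h0), by simp⟩
    | succ k ih =>
      intro γ hk hN
      have hsum : 0 ≤ ∑ i ∈ Finset.range (k + 1), (c (γ i) (γ (i + 1)) + c (γ (i + 1)) (γ i)) :=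
        Finset.sum_nonneg fun i _ => add_nonneg (hc _ _) (hc _ _)
      by_cases hF : γ 0 ∈ F
      · refine ⟨u (γ 0), .base hF, ?_⟩
        have : 0 ≤ 2 * ((k + 1 : ℕ) : ℝ) * δ := by positivity
        linarith
      -- Off `F` the downward slope is below `δ`, so `u` drops by less than the backward cost plus
      -- `δ`. The chain itself pays the forward cost plus `δ`; hence the factor 2.
      · obtain ⟨r, hr, hle⟩ := ih (fun i => γ (i + 1)) hk fun i hi => hN (i + 1) (by omega)
        obtain ⟨hY, hlt⟩ := hFn _ hF
        have h1 := hpslope (γ 0) hY (γ 1) (hN 0 (by omega)).2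
        refine ⟨_, .step hF (hN 0 (by omega)).1 hr, ?_⟩
        rw [Finset.sum_range_succ']
        simp only [zero_add, hs, Nat.cast_add, Nat.cast_one] at *
        linarith
  have hne : ∀ x, {r | ChainValue N c δ u F x r}.Nonempty := by
    intro x
    obtain ⟨k, γ, h0, hk, hN, -⟩ := hchain x 1 one_pos
    obtain ⟨r, hr, -⟩ := hreach k γ hk hN
    exact ⟨r, h0 ▸ hr⟩
  have hle : ∀ x r, ChainValue N c δ u F x r → r ≤ u x := fun x r h =>
    h.le (s := s) (fun x hx y hN => by have := hpmax x (hFn x hx).1 y hN; simp only [hs]; linarith)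
      fun x hx => (hFn x hx).2
  have hbdd : ∀ x, BddAbove {r | ChainValue N c δ u F x r} := fun x => ⟨u x, fun r h => hle x r h⟩
  have hwu : ∀ x, w x ≤ u x := fun x => csSup_le (hne x) fun r h => hle x r h
  have hwF : ∀ x ∈ F, w x = u x := fun x hx => patch_of_mem hx
  have hstep : ∀ x ∉ F, ∀ y, N x y → w y - c x y - δ ≤ w x := by
    intro x hx y hN
    have : w y ≤ w x + c x y + δ := csSup_le (hne y) fun r h => by
      have := le_csSup (hbdd x) (ChainValue.step hx hN h)
      have h2 : r - c x y - δ ≤ w x := this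
      linarith
    linarith
  set σ : α → ℝ := fun x => max (s x) δ with hσ
  have hup : ∀ x ∈ Y, ∀ θ > 0, ∃ y, N x y ∧ w x + σ x - θ ≤ w y - c x y := by
    intro x hxY θ hθ
    by_cases hxF : x ∈ F
    · refine ⟨p x, hpN x hxY, ?_⟩
      -- Slopes do not decrease along steepest steps: the inequality at `p x`, tested with `z = x`,
      -- gives `s x ≤ s (p x)`.
      have hpF : p x ∈ F := by
        intro hpY
        have h1 := hpslope (p x) hpY x (hpN x hxY)
        have h2 : δ ≤ s x := hxF hxY
        simp only [hs] at h2 ⊢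
        linarith
      have h3 : σ x = s x := max_eq_left (hxF hxY)
      rw [hwF _ hpF, hwF _ hxF, h3]
      simp only [hs]
      linarith
    · have hlt : w x - θ < w x := by linarith
      obtain ⟨r, hr, hlt⟩ := exists_lt_of_lt_csSup (hne x) hlt
      have hr' : ChainValue N c δ u F x r := hr
      cases hr' with
      | base h => exact absurd h hxF
      | @step _ y r' hx hN h =>
        refine ⟨y, hN, ?_⟩
        have h1 : r' ≤ w y := le_csSup (hbdd y) h
        simp only [hσ, max_eq_right (hFn x hxF).2.le]
        linarith
  have hdown : ∀ x ∈ Y, ∀ z, N z x → w x - σ x ≤ w z + c z x := by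
    intro x hxY z hz
    have h1 := le_max_left (s x) δ
    have h2 := le_max_right (s x) δ
    by_cases hzF : z ∈ F
    · have h3 := hpslope x hxY z hz
      have h4 := hwu x
      rw [hwF z hzF]
      simp only [hσ, hs] at *
      linarith
    · have := hstep z hzF x hz
      simp only [hσ]
      linarith
  -- near-maxima of `w - v`
  have hbddA : BddAbove (range fun y => w y - v y) :=
    ⟨2 * B, by rintro _ ⟨y, rfl⟩; have := hwu y; have := huB y; have := hvB y; simp only; linarith⟩
  set A := ⨆ y, (w y - v y) with hA
  have hleA : ∀ y, w y - v y ≤ A := fun y => le_ciSup hbddA y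
  have hmA : m + g / 4 < A := by
    obtain ⟨r, hr, hle⟩ := hreach k γ hγk hγN
    rw [hγ0] at hr hle
    have h1 : r ≤ w x := le_csSup (hbdd x) hr
    have := hleA x
    linarith
  -- Adding the inequalities for `w` and `v` cancels the costs and gives `(w - v) y' + (w - v) z ≥ 2
  -- (w - v) y - η`. As `(w - v) z ≤ A`, the defect at `y'` is at most `3 * η`.
  have hnext : ∀ y η, 0 < η → η ≤ g / 4 → A - η ≤ w y - v y →
      ∃ y', A - 3 * η ≤ w y' - v y' ∧ w y + δ - η ≤ w y' := by
    intro y η hη hηg hy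
    have hyY : y ∈ Y := by
      by_contra h
      have h1 := hm y h
      have h2 := hwF y (hFY y h)
      linarith
    obtain ⟨y', hN', hy'⟩ := hup y hyY η hη
    obtain ⟨z, hNz, hz⟩ := hv y hyY
    have h1 := hz y' hN'
    have h2 := hdown y hyY z hNz
    have h3 := hleA z
    have h4 := le_max_right (s y) δ
    have h5 := hc y y'
    simp only [hσ] at *
    exact ⟨y', by linarith, by linarith⟩
  -- After `K` climbs of at least `δ / 2` from a near-maximum, `w` would exceed its bound `B`. The
  -- defect triples each time, so `η` is scaled by `3 ^ K`.
  obtain ⟨K, hK⟩ := exists_nat_gt ((2 * B - A + g + 1) / (δ / 2))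
  rw [div_lt_iff₀ (by positivity)] at hK
  obtain ⟨η, hη, hηg, hηδ⟩ : ∃ η : ℝ, 0 < η ∧ 3 ^ K * η ≤ g / 4 ∧ 3 ^ K * η ≤ δ / 2 := by
    refine ⟨min (g / 4) (δ / 2) / 3 ^ K, by positivity, ?_, ?_⟩ <;>
      rw [mul_div_cancel₀ _ (by positivity)]
    · exact min_le_left _ _
    · exact min_le_right _ _
  obtain ⟨y0, hy0⟩ : ∃ y, A - η < w y - v y :=
    haveI : Nonempty α := ⟨x⟩
    exists_lt_of_lt_ciSup (show A - η < ⨆ y, (w y - v y) by linarith)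
  have hiter : ∀ i ≤ K, ∃ y, A - 3 ^ i * η ≤ w y - v y ∧ w y0 + i * (δ / 2) ≤ w y := by
    intro i
    induction i with
    | zero => exact fun _ => ⟨y0, by simpa using hy0.le, by simp⟩
    | succ i ih =>
      intro hi
      obtain ⟨y, h1, h2⟩ := ih (by omega)
      have h3 : (3 : ℝ) ^ i * η ≤ 3 ^ K * η := by
        gcongr
        · norm_num
        · omega
      obtain ⟨y', h4, h5⟩ := hnext y (3 ^ i * η) (by positivity) (by linarith) h1
      refine ⟨y', by rw [pow_succ]; linarith, ?_⟩
      push_cast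
      linarith
  obtain ⟨y, h1, h2⟩ := hiter K le_rfl
  have h3 := hwu y
  have h4 := huB y
  have h5 := hvB y0
  have h6 : η ≤ 3 ^ K * η := le_mul_of_one_le_left hη.le (one_le_pow₀ (by norm_num))
  linarith

end Patch

/-! ### From almost everywhere gradient bounds to growth along segments -/

section Segment

open Filter Topology

/-- A Lipschitz function on an interval whose derivative is almost everywhere at most `M`. -/
theorem sub_le_of_ae_deriv_le {f : ℝ → ℝ} {K : NNReal} {M : ℝ}
    (hf : LipschitzOnWith K f (Icc 0 1)) (h : ∀ᵐ s, s ∈ Ioo (0 : ℝ) 1 → deriv f s ≤ M) :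
    f 1 - f 0 ≤ M := by
  have hac : AbsolutelyContinuousOnInterval f 0 1 :=
    LipschitzOnWith.absolutelyContinuousOnInterval (K := K) (by rwa [uIcc_of_le zero_le_one])
  rw [← hac.integral_deriv_eq_sub]
  have h1 : ∫ s in (0 : ℝ)..1, deriv f s ≤ ∫ _s in (0 : ℝ)..1, M := by
    apply intervalIntegral.integral_mono_ae_restrict zero_le_one hac.intervalIntegrable_deriv
      intervalIntegrable_const
    rw [EventuallyLE, ← restrict_Ioo_eq_restrict_Icc, ae_restrict_iff' measurableSet_Ioo]
    exact h
  simpa using h1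

variable {E : Type*} [NormedAddCommGroup E] [NormedSpace ℝ E] [FiniteDimensional ℝ E]
  [MeasurableSpace E] [BorelSpace E] {μ : Measure E} [μ.IsAddHaarMeasure]

/-- A property that holds almost everywhere holds almost everywhere on almost all translates of a
line. -/
theorem ae_ae_line_of_ae {p : E → Prop} (h : ∀ᵐ x ∂μ, p x) (y v : E) :
    ∀ᵐ z ∂μ, ∀ᵐ s : ℝ, p (y + z + s • v) := by
  -- The exceptional set is enlarged to a measurable null set so that the two quantifiers can be
  -- exchanged by Fubini.
  set t := toMeasurable μ {x | ¬ p x} with ht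
  have ht0 : μ t = 0 := by rw [ht, measure_toMeasurable]; exact h
  have htm : MeasurableSet t := measurableSet_toMeasurable _ _
  have hpt : ∀ x, x ∉ t → p x := fun x hx => by
    by_contra hp
    exact hx (subset_toMeasurable _ _ hp)
  have h1 : ∀ᵐ s : ℝ, ∀ᵐ z ∂μ, y + z + s • v ∉ t := by
    refine Eventually.of_forall fun s => ?_
    have hq := (measurePreserving_add_left μ (y + s • v)).quasiMeasurePreserving.ae
      (measure_eq_zero_iff_ae_notMem.1 ht0)
    filter_upwards [hq] with z hz
    rwa [show y + z + s • v = y + s • v + z by abel]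
  have hmeas : MeasurableSet {q : ℝ × E | y + q.2 + q.1 • v ∉ t} := by
    have : Continuous fun q : ℝ × E => y + q.2 + q.1 • v := by fun_prop
    exact this.measurable htm.compl
  rw [Measure.ae_ae_comm hmeas] at h1
  filter_upwards [h1] with z hz
  filter_upwards [hz] with s hs using hpt _ hs

/-- A Lipschitz function whose derivative in the direction `v` is almost everywhere at most `M`
grows by at most `M` along a segment in the direction `v`. -/
theorem sub_le_of_ae_fderiv_le {W : Set E} (hW : IsOpen W) {u : E → ℝ} {K : NNReal}
    (hu : LipschitzOnWith K u W) {y v : E} {M : ℝ} (h : ∀ᵐ x ∂μ, x ∈ W → fderiv ℝ u x v ≤ M)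
    (hseg : ∀ s ∈ Icc (0 : ℝ) 1, y + s • v ∈ W) : u (y + v) - u y ≤ M := by
  have hcompact : IsCompact ((fun s : ℝ => y + s • v) '' Icc 0 1) :=
    isCompact_Icc.image (by fun_prop)
  obtain ⟨r, hr, hrW⟩ := hcompact.exists_thickening_subset_open hW
    (by rintro _ ⟨s, hs, rfl⟩; exact hseg s hs)
  have hmem : ∀ z : E, ‖z‖ < r → ∀ s ∈ Icc (0 : ℝ) 1, y + z + s • v ∈ W := by
    intro z hz s hs
    refine hrW (Metric.mem_thickening_iff.2 ⟨y + s • v, ⟨s, hs, rfl⟩, ?_⟩)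
    rwa [dist_eq_norm, show y + z + s • v - (y + s • v) = z by abel]
  have hgood : ∀ᵐ x ∂μ, x ∈ W → DifferentiableAt ℝ u x ∧ fderiv ℝ u x v ≤ M := by
    filter_upwards [h, hu.ae_differentiableWithinAt_of_mem (μ := μ)] with x hx1 hx2 hxW
    exact ⟨(hx2 hxW).differentiableAt (hW.mem_nhds hxW), hx1 hxW⟩
  have hae : ∀ᵐ z ∂μ, ‖z‖ < r → u (y + z + v) - u (y + z) ≤ M := by
    filter_upwards [ae_ae_line_of_ae hgood y v] with z hz hzr
    have hline : LipschitzWith ‖v‖₊ fun s : ℝ => y + z + s • v := by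
      refine LipschitzWith.of_dist_le_mul fun a b => ?_
      rw [dist_add_left, dist_eq_norm, ← sub_smul, norm_smul, mul_comm, Real.dist_eq,
        Real.norm_eq_abs, coe_nnnorm]
    have hf : LipschitzOnWith (K * ‖v‖₊) (fun s : ℝ => u (y + z + s • v)) (Icc 0 1) :=
      hu.comp hline.lipschitzOnWith fun s hs => hmem z hzr s hs
    have := sub_le_of_ae_deriv_le (M := M) hf (by
      filter_upwards [hz] with s hs hs01
      obtain ⟨hd, hle⟩ := hs (hmem z hzr s (Ioo_subset_Icc_self hs01))
      have hl : HasDerivAt (fun s : ℝ => y + z + s • v) v s := by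
        simpa using ((hasDerivAt_id s).smul_const v).const_add (y + z)
      have hc := hd.hasFDerivAt.comp_hasDerivAt s hl
      exact hc.deriv.trans_le hle)
    simpa using this
  -- The estimate holds for almost every parallel segment. A violation on the given one would
  -- persist, by continuity, on an open set of shifts.
  by_contra! hlt
  have h0 : y ∈ W := by simpa using hseg 0 (by simp)
  have h1 : y + v ∈ W := by simpa using hseg 1 (by simp)
  have hc : ContinuousAt (fun z => u (y + z + v) - u (y + z)) 0 := by
    have c1 : ContinuousAt u (y + v) := hu.continuousOn.continuousAt (hW.mem_nhds h1)
    have c0 : ContinuousAt u y := hu.continuousOn.continuousAt (hW.mem_nhds h0)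
    refine ContinuousAt.sub (ContinuousAt.comp (g := u) ?_ (by fun_prop))
      (ContinuousAt.comp (g := u) ?_ (by fun_prop)) <;> simpa
  have hev : ∀ᶠ z in 𝓝 (0 : E), ‖z‖ < r ∧ M < u (y + z + v) - u (y + z) := by
    refine Eventually.and ?_ (hc.eventually_const_lt (by simpa using hlt))
    filter_upwards [Metric.ball_mem_nhds (0 : E) hr] with z hz
    simpa using hz
  obtain ⟨O, hO, hOo, h0O⟩ := eventually_nhds_iff.1 hev
  obtain ⟨z, hzO, hz⟩ := (Measure.dense_of_ae hae).inter_open_nonempty O hOo ⟨0, h0O⟩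
  obtain ⟨hz1, hz2⟩ := hO z hzO
  exact absurd (hz hz1) (not_le.2 hz2)

end Segment

/-! ### Support functions of sublevel sets and the truncated Lagrangian -/

section Conjugate

open Filter Topology

variable {E : Type*} [NormedAddCommGroup E] [InnerProductSpace ℝ E]

/-- The supremum of the affine functions `z ↦ ⟪p, z⟫ - g p`, `p ∈ P`. -/
noncomputable def supAffine (P : Set E) (g : E → ℝ) (z : E) : ℝ :=
  sSup ((fun p => inner ℝ p z - g p) '' P)

section

variable {P : Set E} {g : E → ℝ}

theorem exists_eq_supAffine (hP : IsCompact P) (hne : P.Nonempty) (hg : Continuous g) (z : E) :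
    ∃ p ∈ P, inner ℝ p z - g p = supAffine P g z ∧
      ∀ q ∈ P, inner ℝ q z - g q ≤ supAffine P g z := by
  have hcont : Continuous fun p => inner ℝ p z - g p := by fun_prop
  obtain ⟨p, hp, hmax⟩ := hP.exists_sSup_image_eq_and_ge hne hcont.continuousOn
  exact ⟨p, hp, hmax.1.symm, fun q hq => (hmax.2 q hq).trans hmax.1.ge⟩

theorem le_supAffine (hP : IsCompact P) (hg : Continuous g) {p : E} (hp : p ∈ P) (z : E) :
    inner ℝ p z - g p ≤ supAffine P g z := by
  obtain ⟨-, -, -, h⟩ := exists_eq_supAffine hP ⟨p, hp⟩ hg z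
  exact h p hp

theorem supAffine_le (hne : P.Nonempty) {z : E} {M : ℝ}
    (h : ∀ p ∈ P, inner ℝ p z - g p ≤ M) : supAffine P g z ≤ M :=
  csSup_le (hne.image _) (by rintro _ ⟨p, hp, rfl⟩; exact h p hp)

theorem convexOn_supAffine (hP : IsCompact P) (hne : P.Nonempty) (hg : Continuous g) :
    ConvexOn ℝ univ (supAffine P g) := by
  refine ⟨convex_univ, fun x _ y _ a b ha hb hab => supAffine_le hne fun p hp => ?_⟩
  have h1 := mul_le_mul_of_nonneg_left (le_supAffine hP hg hp x) ha
  have h2 := mul_le_mul_of_nonneg_left (le_supAffine hP hg hp y) hb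
  rw [inner_add_right, inner_smul_right, inner_smul_right, smul_eq_mul, smul_eq_mul]
  have h3 : g p = a * g p + b * g p := by rw [← add_mul, hab, one_mul]
  linarith

theorem exists_lipschitzWith_supAffine (hP : IsCompact P) (hne : P.Nonempty)
    (hg : Continuous g) : ∃ K, LipschitzWith K (supAffine P g) := by
  obtain ⟨R, hR⟩ := hP.isBounded.exists_norm_le
  refine ⟨R.toNNReal, LipschitzWith.of_le_add_mul _ fun x y => supAffine_le hne fun p hp => ?_⟩
  have h1 := le_supAffine hP hg hp y
  have h2 : inner ℝ p (x - y) ≤ R.toNNReal * dist x y := by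
    refine (real_inner_le_norm _ _).trans ?_
    rw [dist_eq_norm]
    gcongr
    exact (hR p hp).trans (Real.le_coe_toNNReal R)
  rw [inner_sub_right] at h2
  linarith

theorem continuous_supAffine (hP : IsCompact P) (hne : P.Nonempty) (hg : Continuous g) :
    Continuous (supAffine P g) :=
  let ⟨_, hK⟩ := exists_lipschitzWith_supAffine hP hne hg
  hK.continuous

end

/-- A convex function which vanishes at the origin and is positive elsewhere. -/
structure PosConvex (H : E → ℝ) : Prop where
  convex : ConvexOn ℝ univ H
  map_zero : H 0 = 0
  pos : ∀ p, p ≠ 0 → 0 < H p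

/-- The sublevel sets of `H`. -/
def level (H : E → ℝ) (k : ℝ) : Set E := {p | H p ≤ k}

/-- The cone function with slope `k`: the support function of `level H k`. -/
noncomputable def cone (H : E → ℝ) (k : ℝ) : E → ℝ := supAffine (level H k) 0

/-- The Lagrangian of `H`, truncated at the level `J`. -/
noncomputable def lag (H : E → ℝ) (J : ℝ) : E → ℝ := supAffine (level H J) H

namespace PosConvex

variable {H : E → ℝ}

theorem nonneg (hH : PosConvex H) (p : E) : 0 ≤ H p := by
  rcases eq_or_ne p 0 with rfl | hp
  · exact hH.map_zero.ge
  · exact (hH.pos p hp).le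

theorem comp_neg (hH : PosConvex H) : PosConvex fun p => H (-p) where
  convex := by
    refine ⟨convex_univ, fun x _ y _ a b ha hb hab => ?_⟩
    have := hH.convex.2 (mem_univ (-x)) (mem_univ (-y)) ha hb hab
    simpa [neg_add, add_comm] using this
  map_zero := by simpa using hH.map_zero
  pos p hp := hH.pos _ (neg_ne_zero.2 hp)

theorem zero_mem_level (hH : PosConvex H) {k : ℝ} (hk : 0 ≤ k) : (0 : E) ∈ level H k :=
  hH.map_zero.trans_le hk

theorem level_nonempty (hH : PosConvex H) {k : ℝ} (hk : 0 ≤ k) : (level H k).Nonempty :=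
  ⟨0, hH.zero_mem_level hk⟩

theorem lag_comp_neg (J : ℝ) (q : E) : lag (fun p => H (-p)) J q = lag H J (-q) := by
  unfold lag supAffine
  congr 1
  ext r
  constructor
  · rintro ⟨p, hp, rfl⟩
    exact ⟨-p, hp, by simp⟩
  · rintro ⟨p, hp, rfl⟩
    exact ⟨-p, by simpa [level] using hp, by simp⟩

theorem cone_le (hH : PosConvex H) {k : ℝ} (hk : 0 ≤ k) {z : E} {M : ℝ}
    (h : ∀ p, H p ≤ k → inner ℝ p z ≤ M) : cone H k z ≤ M :=
  supAffine_le (hH.level_nonempty hk) fun p hp => by simpa using h p hp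

theorem lag_le (hH : PosConvex H) {J : ℝ} (hJ : 0 ≤ J) {q : E} {M : ℝ}
    (h : ∀ p, H p ≤ J → inner ℝ p q - H p ≤ M) : lag H J q ≤ M :=
  supAffine_le (hH.level_nonempty hJ) h

variable [FiniteDimensional ℝ E]

theorem continuous (hH : PosConvex H) : Continuous H := by
  rw [← continuousOn_univ]
  exact hH.convex.continuousOn isOpen_univ

/-- Convexity and `H 0 = 0` give `H p ≥ ‖p‖ * min H` for `‖p‖ ≥ 1`, with the minimum over the unit
sphere; it is positive. -/
theorem isCompact_level (hH : PosConvex H) (k : ℝ) : IsCompact (level H k) := by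
  have hclosed : IsClosed (level H k) := isClosed_le hH.continuous continuous_const
  have := FiniteDimensional.proper_real E
  by_cases hS : (Metric.sphere (0 : E) 1).Nonempty
  · obtain ⟨e, he, hmin⟩ := (isCompact_sphere (0 : E) 1).exists_isMinOn hS
      hH.continuous.continuousOn
    have he0 : e ≠ 0 := by rintro rfl; simp at he
    have hpos := hH.pos e he0
    refine Metric.isCompact_of_isClosed_isBounded hclosed
      (isBounded_iff_forall_norm_le.2 ⟨max 1 (k / H e), fun p hp => ?_⟩)
    by_contra! hlt
    obtain ⟨h1, h2⟩ := max_lt_iff.1 hlt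
    have hp0 : 0 < ‖p‖ := by linarith
    have h3 : H e ≤ H (‖p‖⁻¹ • p) := hmin (by
      simp [norm_smul, inv_mul_cancel₀ hp0.ne'])
    have h4 := hH.convex.2 (mem_univ p) (mem_univ 0) (inv_nonneg.2 hp0.le)
      (sub_nonneg.2 (inv_le_one_of_one_le₀ h1.le)) (by ring)
    rw [smul_zero, add_zero, hH.map_zero, smul_zero, add_zero, smul_eq_mul] at h4
    rw [div_lt_iff₀ hpos] at h2
    have h5 : H e * ‖p‖ ≤ H p := by
      calc H e * ‖p‖ ≤ (‖p‖⁻¹ * H p) * ‖p‖ := by gcongr; exact h3.trans h4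
        _ = H p := by field_simp
    have h6 : H p ≤ k := hp
    linarith
  -- An empty unit sphere means that the space is trivial.
  · refine Metric.isCompact_of_isClosed_isBounded hclosed
      (isBounded_iff_forall_norm_le.2 ⟨0, fun p _ => ?_⟩)
    by_contra! hlt
    exact hS ⟨‖p‖⁻¹ • p, by simp [norm_smul, inv_mul_cancel₀ hlt.ne']⟩

theorem exists_closedBall_subset_level (hH : PosConvex H) (A : ℝ) :
    ∃ k₀, 0 ≤ k₀ ∧ ∀ k, k₀ ≤ k → Metric.closedBall 0 A ⊆ level H k := by
  have := FiniteDimensional.proper_real E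
  obtain ⟨k, hk⟩ := (isCompact_closedBall (0 : E) A).bddAbove_image hH.continuous.continuousOn
  exact ⟨max k 0, le_max_right _ _, fun j hj p hp =>
    (hk (mem_image_of_mem H hp)).trans ((le_max_left _ _).trans hj)⟩

section Cone

variable {k : ℝ}

theorem inner_le_cone (hH : PosConvex H) {p : E} (hp : H p ≤ k) (z : E) :
    inner ℝ p z ≤ cone H k z := by
  have := le_supAffine (hH.isCompact_level k) continuous_zero (p := p) hp z
  simpa [cone] using this

theorem exists_inner_eq_cone (hH : PosConvex H) (hk : 0 ≤ k) (z : E) :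
    ∃ p, H p ≤ k ∧ inner ℝ p z = cone H k z := by
  obtain ⟨p, hp, h, -⟩ := exists_eq_supAffine (hH.isCompact_level k) (hH.level_nonempty hk)
    continuous_zero z
  exact ⟨p, hp, by simpa [cone] using h⟩

theorem cone_nonneg (hH : PosConvex H) (hk : 0 ≤ k) (z : E) : 0 ≤ cone H k z := by
  simpa using hH.inner_le_cone (hH.zero_mem_level hk) z

theorem cone_zero (hH : PosConvex H) (hk : 0 ≤ k) : cone H k 0 = 0 :=
  le_antisymm (hH.cone_le hk fun p _ => by simp) (hH.cone_nonneg hk 0)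

theorem cone_add_le (hH : PosConvex H) (hk : 0 ≤ k) (y z : E) :
    cone H k (y + z) ≤ cone H k y + cone H k z :=
  hH.cone_le hk fun p hp => by
    rw [inner_add_right]
    exact add_le_add (hH.inner_le_cone hp y) (hH.inner_le_cone hp z)

theorem cone_smul (hH : PosConvex H) (hk : 0 ≤ k) {s : ℝ} (hs : 0 ≤ s) (z : E) :
    cone H k (s • z) = s * cone H k z := by
  apply le_antisymm
  · refine hH.cone_le hk fun p hp => ?_
    rw [inner_smul_right]
    exact mul_le_mul_of_nonneg_left (hH.inner_le_cone hp z) hs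
  · obtain ⟨p, hp, h⟩ := hH.exists_inner_eq_cone hk z
    rw [← h, ← inner_smul_right]
    exact hH.inner_le_cone hp _

theorem cone_mono (hH : PosConvex H) (hk : 0 ≤ k) {j : ℝ} (hkj : k ≤ j) (z : E) :
    cone H k z ≤ cone H j z :=
  hH.cone_le hk fun _ hp => hH.inner_le_cone (hp.trans hkj) z

theorem exists_lipschitzWith_cone (hH : PosConvex H) (hk : 0 ≤ k) :
    ∃ K, LipschitzWith K (cone H k) :=
  exists_lipschitzWith_supAffine (hH.isCompact_level k) (hH.level_nonempty hk) continuous_zero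

theorem continuous_cone (hH : PosConvex H) (hk : 0 ≤ k) : Continuous (cone H k) :=
  continuous_supAffine (hH.isCompact_level k) (hH.level_nonempty hk) continuous_zero

theorem mul_norm_le_cone (hH : PosConvex H) {A : ℝ} (hA : 0 ≤ A)
    (h : Metric.closedBall 0 A ⊆ level H k) (z : E) : A * ‖z‖ ≤ cone H k z := by
  rcases eq_or_ne z 0 with rfl | hz
  · have hk : 0 ≤ k := hH.map_zero.ge.trans (h (Metric.mem_closedBall_self hA))
    simp [hH.cone_zero hk]
  · have hz' := norm_pos_iff.2 hz
    have hmem : (A * ‖z‖⁻¹) • z ∈ Metric.closedBall (0 : E) A := by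
      rw [mem_closedBall_zero_iff, norm_smul, norm_mul, norm_inv, norm_norm, mul_assoc,
        inv_mul_cancel₀ hz'.ne', mul_one, Real.norm_of_nonneg hA]
    have := hH.inner_le_cone (h hmem) z
    rw [inner_smul_left, real_inner_self_eq_norm_sq] at this
    calc A * ‖z‖ = A * ‖z‖⁻¹ * ‖z‖ ^ 2 := by field_simp
      _ ≤ _ := by simpa using this

/-- Cone functions dominate any multiple of the norm if the slope is large. -/
theorem exists_mul_norm_le_cone (hH : PosConvex H) (A : ℝ) :
    ∃ k₀, 0 ≤ k₀ ∧ ∀ k, k₀ ≤ k → ∀ z, A * ‖z‖ ≤ cone H k z := by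
  obtain ⟨k₀, h0, h⟩ := hH.exists_closedBall_subset_level (max A 0)
  refine ⟨k₀, h0, fun k hk z => ?_⟩
  calc A * ‖z‖ ≤ max A 0 * ‖z‖ := by gcongr; exact le_max_left _ _
    _ ≤ _ := hH.mul_norm_le_cone (le_max_right _ _) (h k hk) z

/-- The spare term `‖z‖` later confines maximizers to small balls and bounds the slope of `k ↦ cone
H k z` from below. -/
theorem exists_cone_add_norm_le (hH : PosConvex H) (hk : 0 ≤ k) :
    ∃ k₀, k ≤ k₀ ∧ ∀ j, k₀ ≤ j → ∀ z, cone H k z + ‖z‖ ≤ cone H j z := by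
  obtain ⟨K, hK⟩ := hH.exists_lipschitzWith_cone hk
  obtain ⟨k₀, -, h⟩ := hH.exists_mul_norm_le_cone (K + 1)
  refine ⟨max k k₀, le_max_left _ _, fun j hj z => ?_⟩
  have h1 := h j ((le_max_right _ _).trans hj) z
  have h2 := hK.dist_le_mul z 0
  rw [hH.cone_zero hk, dist_zero_right, dist_zero_right, Real.norm_eq_abs] at h2
  linarith [le_abs_self (cone H k z)]

/-- Duality: a closed convex set is described by its support function. -/
theorem le_of_forall_inner_le_cone (hH : PosConvex H) (hk : 0 ≤ k) {p : E}
    (h : ∀ z, inner ℝ p z ≤ cone H k z) : H p ≤ k := by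
  by_contra hp
  have := FiniteDimensional.complete ℝ E
  have hconv : Convex ℝ (level H k) := by
    have := hH.convex.convex_le k
    simpa [level] using this
  obtain ⟨f, s, hf1, hf2⟩ := geometric_hahn_banach_closed_point hconv
    (hH.isCompact_level k).isClosed hp
  obtain ⟨z, rfl⟩ := (InnerProductSpace.toDual ℝ E).surjective f
  have h1 : cone H k z ≤ s := hH.cone_le hk fun q hq => by
    have := hf1 q hq
    rw [InnerProductSpace.toDual_apply_apply, real_inner_comm] at this
    exact this.le
  rw [InnerProductSpace.toDual_apply_apply, real_inner_comm] at hf2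
  linarith [h z]

/-- Convexity of `H` puts convex combinations of points of two levels in the combined level. -/
theorem concaveOn_cone (hH : PosConvex H) (z : E) :
    ConcaveOn ℝ (Ici 0) fun k => cone H k z := by
  refine ⟨convex_Ici 0, fun j hj k hk a b ha hb hab => ?_⟩
  obtain ⟨p, hp, hpz⟩ := hH.exists_inner_eq_cone hj z
  obtain ⟨q, hq, hqz⟩ := hH.exists_inner_eq_cone hk z
  simp only
  rw [← hpz, ← hqz, smul_eq_mul, smul_eq_mul, ← real_inner_smul_left, ← real_inner_smul_left,
    ← inner_add_left]
  refine hH.inner_le_cone ((hH.convex.2 (mem_univ p) (mem_univ q) ha hb hab).trans ?_) z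
  simp only [smul_eq_mul]
  gcongr

end Cone

section Lag

variable {J : ℝ}

theorem continuous_lag (hH : PosConvex H) (hJ : 0 ≤ J) : Continuous (lag H J) :=
  continuous_supAffine (hH.isCompact_level J) (hH.level_nonempty hJ) hH.continuous

theorem convexOn_lag (hH : PosConvex H) (hJ : 0 ≤ J) : ConvexOn ℝ univ (lag H J) :=
  convexOn_supAffine (hH.isCompact_level J) (hH.level_nonempty hJ) hH.continuous

theorem inner_sub_le_lag (hH : PosConvex H) {p : E} (hp : H p ≤ J) (q : E) :
    inner ℝ p q - H p ≤ lag H J q :=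
  le_supAffine (hH.isCompact_level J) hH.continuous (p := p) hp q

theorem lag_nonneg (hH : PosConvex H) (hJ : 0 ≤ J) (q : E) : 0 ≤ lag H J q := by
  simpa [hH.map_zero] using hH.inner_sub_le_lag (hH.zero_mem_level hJ) q

theorem lag_zero (hH : PosConvex H) (hJ : 0 ≤ J) : lag H J 0 = 0 :=
  le_antisymm (hH.lag_le hJ fun p _ => by simpa using hH.nonneg p) (hH.lag_nonneg hJ 0)

theorem cone_sub_le_lag (hH : PosConvex H) {k : ℝ} (hk : 0 ≤ k) (hkJ : k ≤ J) (q : E) :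
    cone H k q - k ≤ lag H J q := by
  obtain ⟨p, hp, h⟩ := hH.exists_inner_eq_cone hk q
  rw [← h]
  exact le_trans (by linarith) (hH.inner_sub_le_lag (hp.trans hkJ) q)

/-- On each ray from the origin, the Lagrangian nearly touches the affine function
`cone H k - k` not too far from the origin. -/
theorem exists_lag_smul_le (hH : PosConvex H) {k k' : ℝ} (hk' : 0 ≤ k') (hkk : k' < k)
    (hkJ : k < J) {e : E} (he : ‖e‖ = 1) (hJ : cone H k e + ‖e‖ ≤ cone H J e) :
    ∃ r, 0 < r ∧ r ≤ J ∧ lag H J (r • e) ≤ r * cone H k e - k' := by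
  set ψ : ℝ → ℝ := fun j => cone H j e with hψ
  have hconc : ConcaveOn ℝ (Ici 0) ψ := hH.concaveOn_cone e
  have hk : 0 ≤ k := hk'.trans hkk.le
  -- By concavity the secant slope over `[k', k]` is at least that over `[k, J]`, where `ψ` grows by
  -- at least `‖e‖ = 1`.
  have h1 : 1 ≤ (J - k) * ((ψ k - ψ k') / (k - k')) := by
    have := hconc.slope_anti_adjacent (x := k') (y := k) (z := J) hk' (hk.trans hkJ.le) hkk hkJ
    rw [div_le_iff₀ (by linarith)] at this
    simp only [hψ] at *
    linarith
  have hd : 0 < (ψ k - ψ k') / (k - k') := by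
    by_contra! h
    nlinarith
  have hd' : 0 < ψ k - ψ k' := by
    have := mul_pos hd (sub_pos.2 hkk)
    rwa [div_mul_cancel₀ _ (sub_pos.2 hkk).ne'] at this
  set d := (ψ k - ψ k') / (k - k') with hdd
  -- At radius `1 / d` the Lagrangian is controlled by the supremum of `(ψ h - d * h) / d`; since
  -- `d` is the secant slope on `[k', k]`, concavity bounds `ψ h - d * h` by `ψ k - d * k'`.
  refine ⟨d⁻¹, inv_pos.2 hd, ?_, ?_⟩
  · rw [inv_le_iff_one_le_mul₀ hd]
    nlinarith
  · refine hH.lag_le (hk.trans hkJ.le) fun p hp => ?_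
    have h2 : inner ℝ p e ≤ ψ (H p) := hH.inner_le_cone le_rfl e
    rw [inner_smul_right]
    have h3 : ψ (H p) - d * H p ≤ ψ k - d * k' := by
      rcases lt_or_ge (H p) k' with h | h
      · have := hconc.slope_anti_adjacent (x := H p) (y := k') (z := k) (hH.nonneg p) hk h hkk
        rw [← hdd, le_div_iff₀ (by linarith)] at this
        linarith
      rcases le_or_gt (H p) k with h' | h'
      · have h4 : ψ (H p) ≤ ψ k := hH.cone_mono (hH.nonneg p) h' e
        nlinarith
      · have := hconc.slope_anti_adjacent (x := k') (y := k) (z := H p) hk' (hH.nonneg p) hkk h'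
        rw [← hdd, div_le_iff₀ (by linarith)] at this
        nlinarith
    have h5 : d⁻¹ * inner ℝ p e ≤ d⁻¹ * (ψ k - d * k' + d * H p) := by
      gcongr
      linarith
    have h6 : d⁻¹ * (ψ k - d * k' + d * H p) = d⁻¹ * ψ k - k' + H p := by
      field_simp
    simp only [hψ] at *
    linarith

/-- The doubling property of the Lagrangian beyond the points where it nearly touches
`cone H k - k`. -/
theorem two_mul_lag_add_le (hH : PosConvex H) {k k' : ℝ} (hk : 0 ≤ k) (hkJ : k ≤ J) {q : E}
    {s : ℝ} (hs0 : 0 ≤ s) (hs1 : s ≤ 1) (h : lag H J (s • q) ≤ s * cone H k q - k') :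
    2 * lag H J q + k - 2 * (k - k') ≤ lag H J ((2 : ℝ) • q) := by
  have hJ : 0 ≤ J := hk.trans hkJ
  have h2 := hH.cone_sub_le_lag hk hkJ ((2 : ℝ) • q)
  rw [hH.cone_smul hk (by norm_num)] at h2
  have h3 := hH.cone_sub_le_lag hk hkJ (s • q)
  rw [hH.cone_smul hk hs0] at h3
  -- With this weight `q` is the convex combination of `s • q` and `2 • q`. Convexity bounds `lag H
  -- J q`, and `2 * (1 - l) ≤ 1` lets the excess of `lag H J (2 • q)` over `2 * cone H k q - k`
  -- absorb the rest.
  set l := (2 - s)⁻¹ with hl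
  have hpos : 0 < 2 - s := by linarith
  have hl0 : 0 < l := inv_pos.2 hpos
  have hl2 : l * (2 - s) = 1 := inv_mul_cancel₀ hpos.ne'
  have hl1 : l ≤ 1 := by nlinarith
  have hl3 : 1 - l = l * (1 - s) := by linarith
  have hl4 : 2 * (1 - l) ≤ 1 := by nlinarith
  have hconv := (hH.convexOn_lag hJ).2 (mem_univ (s • q)) (mem_univ ((2 : ℝ) • q)) hl0.le
    (sub_nonneg.2 hl1) (by ring)
  have hq : l • s • q + (1 - l) • (2 : ℝ) • q = q := by
    rw [smul_smul, smul_smul, ← add_smul, show l * s + (1 - l) * 2 = 1 by linarith, one_smul]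
  rw [hq, smul_eq_mul, smul_eq_mul] at hconv
  have h4 : l * lag H J (s • q) ≤ l * (s * cone H k q - k') := by gcongr
  have h5 : 0 ≤ (1 - 2 * (1 - l)) * (lag H J ((2 : ℝ) • q) - (2 * cone H k q - k)) :=
    mul_nonneg (by linarith) (by linarith)
  have h6 : l * (k - k') ≤ k - k' := by
    have : 0 ≤ k - k' := by linarith
    nlinarith
  have h7 : l * (s * cone H k q) + (1 - l) * (2 * cone H k q) = cone H k q := by
    have : l * s + (1 - l) * 2 = 1 := by linarith
    calc _ = (l * s + (1 - l) * 2) * cone H k q := by ring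
      _ = _ := by rw [this, one_mul]
  nlinarith

/-- Long straight chains with short steps have small cost. -/
theorem eventually_mul_lag_le (hH : PosConvex H) (hJ : 0 ≤ J) (d : E) {η : ℝ} (hη : 0 < η) :
    ∀ᶠ N : ℕ in atTop, N * lag H J ((N : ℝ)⁻¹ • d) ≤ η := by
  -- The quantity is the supremum of `⟪p, d⟫ - N * H p`. Only `p` with `⟪p, d⟫ ≥ η` matter; on this
  -- compact set, which misses the origin, `H` is bounded away from zero.
  set S : Set E := level H J ∩ {p | η ≤ inner ℝ p d} with hS
  have hScomp : IsCompact S := (hH.isCompact_level J).inter_right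
    (isClosed_le continuous_const (by fun_prop))
  obtain ⟨μ, hμ, hμS⟩ : ∃ μ > 0, ∀ p ∈ S, μ ≤ H p := by
    rcases S.eq_empty_or_nonempty with h | h
    · exact ⟨1, one_pos, by simp [h]⟩
    · obtain ⟨p, hp, hmin⟩ := hScomp.exists_isMinOn h hH.continuous.continuousOn
      refine ⟨H p, hH.pos p ?_, fun q hq => hmin hq⟩
      rintro rfl
      have : η ≤ inner ℝ (0 : E) d := hp.2
      rw [inner_zero_left] at this
      linarith
  obtain ⟨N₀, hN₀⟩ := exists_nat_gt (cone H J d / μ)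
  filter_upwards [eventually_ge_atTop (max N₀ 1)] with N hN
  have hN1 : (0 : ℝ) < N := by
    have := (le_max_right N₀ 1).trans hN
    exact_mod_cast this
  have hNN : (N₀ : ℝ) ≤ N := by exact_mod_cast (le_max_left N₀ 1).trans hN
  rw [← le_div_iff₀' hN1]
  refine hH.lag_le hJ fun p hp => ?_
  rw [inner_smul_right, le_div_iff₀' hN1, mul_sub, mul_inv_cancel_left₀ hN1.ne']
  by_cases h : η ≤ inner ℝ p d
  · have h1 := hμS p ⟨hp, h⟩
    rw [div_lt_iff₀ hμ] at hN₀
    have h2 := hH.inner_le_cone hp d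
    have h3 : N₀ * μ ≤ N * H p := by gcongr
    linarith
  · have : 0 ≤ N * H p := mul_nonneg hN1.le (hH.nonneg p)
    linarith

end Lag

end PosConvex

end Conjugate

/-! ### Subminimizers enjoy comparison with cones -/

section ConeComparison

open Filter Topology

/-- Comparison with the cone functions from above, with vertex anywhere in `U`. -/
def ConeComparison {E : Type*} [NormedAddCommGroup E] [InnerProductSpace ℝ E] (H u : E → ℝ)
    (U : Set E) : Prop :=
  ∀ (V : Set E) (x : E) (k : ℝ), 0 ≤ k → IsOpen V → IsCompact (closure V) → closure V ⊆ U →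
    (∀ z ∈ frontier V, u z ≤ u x + cone H k (z - x)) → ∀ z ∈ V, u z ≤ u x + cone H k (z - x)

variable {n : ℕ} {H u : EuclideanSpace ℝ (Fin n) → ℝ} {U : Set (EuclideanSpace ℝ (Fin n))}

theorem LipLoc.continuousOn (hU : IsOpen U) (hu : LipLoc u U) : ContinuousOn u U := by
  intro x hx
  obtain ⟨r, hr, hrU⟩ := Metric.nhds_basis_closedBall.mem_iff.1 (hU.mem_nhds hx)
  have hcl : closure (Metric.ball x r) ⊆ Metric.closedBall x r := Metric.closure_ball_subset_closedBall
  obtain ⟨K, hK⟩ := hu (Metric.ball x r) ⟨Metric.isOpen_ball,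
    (isCompact_closedBall x r).of_isClosed_subset isClosed_closure hcl, hcl.trans hrU⟩
  exact (hK.continuousOn.continuousAt (Metric.ball_mem_nhds x hr)).continuousWithinAt

/-- The gradient of a cone function with slope `k` has level at most `k`. -/
theorem PosConvex.gradient_cone_le (hH : PosConvex H) {k : ℝ} (hk : 0 ≤ k) (a : ℝ)
    (x₀ x : EuclideanSpace ℝ (Fin n)) : H (gradient (fun z => a + cone H k (z - x₀)) x) ≤ k := by
  set w := fun z => a + cone H k (z - x₀) with hw
  by_cases hd : DifferentiableAt ℝ w x
  · refine hH.le_of_forall_inner_le_cone hk fun h => ?_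
    rw [inner_gradient_left]
    have hl : HasDerivAt (fun s : ℝ => w (x + s • h)) (fderiv ℝ w x h) 0 := by
      have h1 : HasDerivAt (fun s : ℝ => x + s • h) h 0 := by
        simpa using ((hasDerivAt_id (0 : ℝ)).smul_const h).const_add x
      have h2 : HasFDerivAt w (fderiv ℝ w x) (x + (0 : ℝ) • h) := by simpa using hd.hasFDerivAt
      exact h2.comp_hasDerivAt 0 h1
    refine le_of_tendsto hl.tendsto_slope_zero_right ?_
    filter_upwards [self_mem_nhdsWithin] with s hs
    have hs' : 0 < s := hs
    rw [smul_eq_mul, inv_mul_le_iff₀ hs', ← hH.cone_smul hk hs'.le]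
    have := hH.cone_add_le hk (x - x₀) (s • h)
    simp only [hw, zero_add, zero_smul, add_zero]
    rw [show x + s • h - x₀ = x - x₀ + s • h by abel]
    linarith
  -- Where the cone is not differentiable, `gradient` takes the default value `0`, which is harmless
  -- because `H 0 = 0`.
  · rw [gradient_eq_zero_of_not_differentiableAt hd, hH.map_zero]
    exact hk

/-- A bound on `H(Du)` in an open set bounds the growth of `u` along segments in this set. -/
theorem sub_le_cone_of_supHD_le (hH : PosConvex H) {W : Set (EuclideanSpace ℝ (Fin n))}
    (hW : IsOpen W) {K : NNReal} (hu : LipschitzOnWith K u W) {k : ℝ}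
    (hk : supHD H u W ≤ (k : EReal)) {y v : EuclideanSpace ℝ (Fin n)}
    (hseg : ∀ s ∈ Icc (0 : ℝ) 1, y + s • v ∈ W) : u (y + v) - u y ≤ cone H k v := by
  refine sub_le_of_ae_fderiv_le (μ := volume) hW hu ?_ hseg
  have h1 : ∀ᵐ x ∂volume.restrict W, ((H (gradient u x) : ℝ) : EReal) ≤ supHD H u W :=
    ae_le_essSup
  rw [ae_restrict_iff' hW.measurableSet] at h1
  filter_upwards [h1] with x hx hxW
  have h2 : H (gradient u x) ≤ k := EReal.coe_le_coe_iff.1 ((hx hxW).trans hk)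
  have h3 := hH.inner_le_cone h2 v
  rwa [inner_gradient_left] at h3

/-- Absolutely subminimizing functions enjoy comparison with cones from above. -/
theorem AbsSubminimizing.coneComparison (hH : PosConvex H) (hU : IsOpen U)
    (hu : AbsSubminimizing H u U) : ConeComparison H u U := by
  intro V x₀ k hk hV hVc hVU hfr x hxV
  by_contra! hx
  set w := fun z => u x₀ + cone H k (z - x₀) with hw
  obtain ⟨L, hL⟩ := hH.exists_lipschitzWith_cone hk
  have hwL : LipschitzWith L w := LipschitzWith.of_dist_le_mul fun a b => by
    have := hL.dist_le_mul (a - x₀) (b - x₀)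
    simpa [hw] using this
  have huc : ContinuousOn u U := hu.1.continuousOn hU
  set Ω := {z ∈ V | w z < u z} with hΩ
  have hΩV : Ω ⊆ V := fun z hz => hz.1
  have hcl : closure Ω ⊆ closure V := closure_mono hΩV
  have hΩo : IsOpen Ω := by
    have hc : ContinuousOn (fun z => u z - w z) V :=
      (huc.mono (subset_closure.trans hVU)).sub hwL.continuous.continuousOn
    have := hc.isOpen_inter_preimage hV (isOpen_Ioi (a := (0 : ℝ)))
    convert this using 1
    ext z
    simp [hΩ]
  have hΩU : CompactlyInside Ω U :=
    ⟨hΩo, hVc.of_isClosed_subset isClosed_closure hcl, hcl.trans hVU⟩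
  have hfrΩ : ∀ z ∈ frontier Ω, w z = u z := by
    intro z hz
    have hzU : z ∈ U := hVU (hcl hz.1)
    apply le_antisymm
    · have huz : ContinuousAt u z := huc.continuousAt (hU.mem_nhds hzU)
      have hfreq : ∃ᶠ y in 𝓝 z, y ∈ Ω := mem_closure_iff_frequently.1 hz.1
      by_contra! hlt
      exact hfreq ((huz.eventually_lt hwL.continuous.continuousAt hlt).mono
        fun y hy hyΩ => absurd hyΩ.2 (not_lt.2 hy.le))
    · have hzΩ : z ∉ Ω := by
        have := hz.2
        rwa [hΩo.interior_eq] at this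
      by_cases hzV : z ∈ V
      · by_contra! h
        exact hzΩ ⟨hzV, h⟩
      · exact hfr z ⟨hcl hz.1, by rwa [hV.interior_eq]⟩
  have hsup : supHD H u Ω ≤ (k : EReal) := by
    refine (hu.2 Ω w hΩU (fun V _ => ⟨L, hwL.lipschitzOnWith⟩) hwL.continuous.continuousOn hfrΩ
      fun z hz => hz.2.le).trans ?_
    exact essSup_le_of_ae_le _ (Eventually.of_forall fun z =>
      EReal.coe_le_coe_iff.2 (hH.gradient_cone_le hk _ x₀ z))
  obtain ⟨K, hK⟩ := hu.1 Ω hΩU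
  -- the last exit from `Ω` on the way from `x` to the vertex
  set γ : ℝ → EuclideanSpace ℝ (Fin n) := fun s => x + s • (x₀ - x) with hγ
  have hγc : Continuous γ := by fun_prop
  set T := Icc (0 : ℝ) 1 ∩ γ ⁻¹' Ωᶜ with hT
  have hTc : IsCompact T := isCompact_Icc.inter_right (hΩo.isClosed_compl.preimage hγc)
  -- The cone equals `u` at its vertex, so the vertex is never in `Ω`.
  have hT1 : (1 : ℝ) ∈ T := by
    refine ⟨by simp, fun h => ?_⟩
    have h1 := h.2
    simp [hγ, hw, hH.cone_zero hk] at h1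
  obtain ⟨τ, hτT, hτmin⟩ := hTc.exists_isLeast ⟨1, hT1⟩
  have hxΩ : x ∈ Ω := ⟨hxV, hx⟩
  have hτ0 : 0 < τ := by
    rcases hτT.1.1.eq_or_lt with h | h
    · exact absurd hxΩ (by have := hτT.2; rw [← h] at this; simpa [hγ] using this)
    · exact h
  have hin : ∀ s, 0 ≤ s → s < τ → γ s ∈ Ω := by
    intro s hs0 hs
    by_contra h
    exact absurd (hτmin ⟨⟨hs0, hs.le.trans hτT.1.2⟩, h⟩) (not_le.2 hs)
  have hγτ : γ τ ∈ frontier Ω := by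
    refine ⟨?_, by rw [hΩo.interior_eq]; exact hτT.2⟩
    have hmem : τ ∈ closure (Ico 0 τ) := by
      rw [closure_Ico hτ0.ne]
      exact right_mem_Icc.2 hτ0.le
    exact map_mem_closure hγc hmem fun s hs => hin s hs.1 hs.2
  have hstep : ∀ s, 0 ≤ s → s < τ → u x - u (γ s) ≤ s * cone H k (x - x₀) := by
    intro s hs0 hs
    have := sub_le_cone_of_supHD_le hH hΩo hK hsup (y := γ s) (v := s • (x - x₀)) (by
      intro r hr
      have : γ s + r • s • (x - x₀) = γ (s * (1 - r)) := by
        simp only [hγ]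
        module
      rw [this]
      refine hin _ (mul_nonneg hs0 (by linarith [hr.2])) (lt_of_le_of_lt ?_ hs)
      nlinarith [hr.1])
    rw [hH.cone_smul hk hs0] at this
    have hx' : γ s + s • (x - x₀) = x := by
      simp only [hγ]
      module
    rwa [hx'] at this
  -- The segment estimate needs the whole segment in `Ω`, so the exit point is reached only as a
  -- limit.
  have hlim : u x - u (γ τ) ≤ τ * cone H k (x - x₀) := by
    have hcu : ContinuousAt (fun s => u x - u (γ s)) τ := by
      have : ContinuousAt u (γ τ) := huc.continuousAt (hU.mem_nhds (hVU (hcl hγτ.1)))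
      exact continuousAt_const.sub (ContinuousAt.comp (g := u) this hγc.continuousAt)
    have hcv : ContinuousAt (fun s => s * cone H k (x - x₀)) τ := by fun_prop
    have hcu' := hcu.tendsto.mono_left (nhdsWithin_le_nhds (s := Iio τ))
    have hcv' := hcv.tendsto.mono_left (nhdsWithin_le_nhds (s := Iio τ))
    refine le_of_tendsto_of_tendsto hcu' hcv' ?_
    filter_upwards [Ioo_mem_nhdsLT hτ0] with s hs
    exact hstep s hs.1.le hs.2
  have hγw : u (γ τ) = u x₀ + (1 - τ) * cone H k (x - x₀) := by
    rw [← hfrΩ _ hγτ, ← hH.cone_smul hk (sub_nonneg.2 hτT.1.2)]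
    simp only [hw, hγ]
    congr 2
    module
  have : w x < u x := hx
  simp only [hw] at this
  linarith

end ConeComparison

/-! ### The convexity criterion -/

section Slope

open Filter Topology

variable {E : Type*} [NormedAddCommGroup E] [InnerProductSpace ℝ E] {H u : E → ℝ}

/-- The cost of a step from `x` to `y` in time `t`. -/
noncomputable def stepCost (H : E → ℝ) (J t : ℝ) (x y : E) : ℝ := t * lag H J (t⁻¹ • (y - x))

theorem stepCost_midpoint {J t : ℝ} (x z : E) :
    stepCost H J t x (midpoint ℝ x z) = 2⁻¹ * stepCost H J (2 * t) x z ∧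
      stepCost H J t (midpoint ℝ x z) z = 2⁻¹ * stepCost H J (2 * t) x z := by
  have h1 : t⁻¹ • (midpoint ℝ x z - x) = (2 * t)⁻¹ • (z - x) := by
    rw [midpoint_sub_left, mul_inv, smul_smul, invOf_eq_inv, mul_comm]
  have h2 : t⁻¹ • (z - midpoint ℝ x z) = (2 * t)⁻¹ • (z - x) := by
    rw [right_sub_midpoint, mul_inv, smul_smul, invOf_eq_inv, mul_comm]
  unfold stepCost
  rw [h1, h2]
  exact ⟨by ring, by ring⟩

variable [FiniteDimensional ℝ E] {U : Set E} {J t : ℝ}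

theorem PosConvex.stepCost_nonneg (hH : PosConvex H) (hJ : 0 ≤ J) (ht : 0 ≤ t) (x y : E) :
    0 ≤ stepCost H J t x y :=
  mul_nonneg ht (hH.lag_nonneg hJ _)

theorem PosConvex.stepCost_self (hH : PosConvex H) (hJ : 0 ≤ J) (x : E) :
    stepCost H J t x x = 0 := by
  simp [stepCost, hH.lag_zero hJ]

theorem PosConvex.continuous_stepCost (hH : PosConvex H) (hJ : 0 ≤ J) (x : E) :
    Continuous (stepCost H J t x) := by
  have := hH.continuous_lag hJ
  unfold stepCost
  fun_prop

theorem PosConvex.cone_sub_le_stepCost (hH : PosConvex H) {k : ℝ} (hk : 0 ≤ k) (hkJ : k ≤ J)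
    (ht : 0 < t) (x y : E) : cone H k (y - x) - t * k ≤ stepCost H J t x y := by
  have h := mul_le_mul_of_nonneg_left (hH.cone_sub_le_lag hk hkJ (t⁻¹ • (y - x))) ht.le
  rw [hH.cone_smul hk (inv_nonneg.2 ht.le), mul_sub, mul_inv_cancel_left₀ ht.ne'] at h
  exact h

theorem PosConvex.stepCost_two_mul_le (hH : PosConvex H) (hJ : 0 ≤ J) (ht : 0 < t)
    (x y z : E) : stepCost H J (2 * t) x z ≤ stepCost H J t x y + stepCost H J t y z := by
  have h := (hH.convexOn_lag hJ).2 (mem_univ (t⁻¹ • (y - x))) (mem_univ (t⁻¹ • (z - y)))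
    (by norm_num : (0 : ℝ) ≤ 2⁻¹) (by norm_num : (0 : ℝ) ≤ 2⁻¹) (by norm_num)
  have he : (2 : ℝ)⁻¹ • t⁻¹ • (y - x) + (2 : ℝ)⁻¹ • t⁻¹ • (z - y) = (2 * t)⁻¹ • (z - x) := by
    rw [mul_inv]
    module
  rw [he, smul_eq_mul, smul_eq_mul] at h
  have h2 := mul_le_mul_of_nonneg_left h (by positivity : (0 : ℝ) ≤ 2 * t)
  unfold stepCost
  linarith

/-- If `u` lies below `u x + 2 t k₀` plus the cost of steps from `x` in time `2 t`, then comparison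
with cones bounds `u` by nearly `u x + t k₀` plus the cost in time `t`. -/
theorem ConeComparison.sub_stepCost_le_add (hH : PosConvex H) (hu : ConeComparison H u U) {x : E}
    {R k k₀ : ℝ} (hk₀ : 0 ≤ k₀) (hk : k₀ < k) (hkJ : k < J)
    (hJ : ∀ z, cone H k z + ‖z‖ ≤ cone H J z) (ht : 0 < t) (htR : 2 * t * J ≤ R)
    (hball : Metric.closedBall x R ⊆ U)
    (hle : ∀ w ∈ Metric.closedBall x R, u w ≤ u x + 2 * t * k₀ + stepCost H J (2 * t) x w)
    {y : E} (hy : y ∈ Metric.closedBall x R) :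
    u y - stepCost H J t x y ≤ u x + t * k₀ + 2 * t * (k - k₀) := by
  have := FiniteDimensional.proper_real E
  have hk0 : 0 ≤ k := hk₀.trans hk.le
  have hJ0 : 0 ≤ J := hk0.trans hkJ.le
  obtain ⟨k', hk1, hk2⟩ := exists_between hk
  obtain ⟨k'', hk3, hk4⟩ := exists_between hk2
  -- Where `f ≤ 0`, the assumed bound with time `2 t` lies below the cone of slope `k`. The margins
  -- `k₀ < k' < k'' < k` make `f` positive at the origin and strictly negative somewhere on each
  -- ray.
  set f : E → ℝ := fun z => 2 * t * lag H J ((2 * t)⁻¹ • z) + 2 * t * k' - cone H k z with hf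
  have hfc : Continuous f := by
    have := hH.continuous_lag hJ0
    have := hH.continuous_cone hk0
    fun_prop
  have hf0 : 0 < f 0 := by
    simp only [hf, smul_zero, hH.lag_zero hJ0, hH.cone_zero hk0]
    have : 0 < 2 * t * k' := by have : 0 < k' := by linarith
                                positivity
    linarith
  have hdip : ∀ z, z ≠ 0 → ∃ r, 0 < r ∧ r * ‖z‖ ≤ 2 * t * J ∧ f (r • z) < 0 := by
    intro z hz
    have hz' := norm_pos_iff.2 hz
    obtain ⟨r, hr0, hrJ, hr⟩ := hH.exists_lag_smul_le (k := k) (k' := k'') (by linarith) hk4 hkJ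
      (e := ‖z‖⁻¹ • z) (by rw [norm_smul, norm_inv, norm_norm, inv_mul_cancel₀ hz'.ne']) (hJ _)
    refine ⟨2 * t * r * ‖z‖⁻¹, by positivity, ?_, ?_⟩
    · rw [mul_assoc, inv_mul_cancel₀ hz'.ne', mul_one]
      gcongr
    · simp only [hf]
      have h1 : (2 * t)⁻¹ • (2 * t * r * ‖z‖⁻¹) • z = r • ‖z‖⁻¹ • z := by
        rw [smul_smul, smul_smul]
        congr 1
        field_simp
      rw [h1, hH.cone_smul hk0 (by positivity)]
      rw [hH.cone_smul hk0 (by positivity)] at hr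
      have h2 := mul_le_mul_of_nonneg_left hr (by positivity : 0 ≤ 2 * t)
      have h3 : 2 * t * k' < 2 * t * k'' := by gcongr
      linarith
  have hconv : ∀ (z : E) (s r : ℝ), 0 ≤ s → s < 1 → 1 < r → f (s • z) ≤ 0 → f (r • z) < 0 → f z < 0 := by
    intro z s r hs0 hs1 hr1 hs hr
    set l := (1 - s) / (r - s) with hl
    have hrs : 0 < r - s := by linarith
    have hl0 : 0 < l := div_pos (by linarith) hrs
    have hl1 : 0 ≤ 1 - l := by
      rw [sub_nonneg, hl, div_le_one hrs]
      linarith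
    have hls : (1 - l) * s + l * r = 1 := by
      rw [hl]
      field_simp
      ring
    have h1 := (hH.convexOn_lag hJ0).2 (mem_univ ((2 * t)⁻¹ • s • z))
      (mem_univ ((2 * t)⁻¹ • r • z)) hl1 hl0.le (by ring)
    have h2 : (1 - l) • (2 * t)⁻¹ • s • z + l • (2 * t)⁻¹ • r • z = (2 * t)⁻¹ • z := by
      calc _ = (2 * t)⁻¹ • ((1 - l) * s + l * r) • z := by module
        _ = _ := by rw [hls, one_smul]
    rw [h2, smul_eq_mul, smul_eq_mul] at h1
    have h3 := mul_le_mul_of_nonneg_left h1 (by positivity : 0 ≤ 2 * t)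
    have h4 : cone H k z = (1 - l) * cone H k (s • z) + l * cone H k (r • z) := by
      rw [hH.cone_smul hk0 hs0, hH.cone_smul hk0 (by linarith : 0 ≤ r)]
      calc cone H k z = ((1 - l) * s + l * r) * cone H k z := by rw [hls, one_mul]
        _ = _ := by ring
    have h5 : f z ≤ (1 - l) * f (s • z) + l * f (r • z) := by
      simp only [hf]
      rw [h4]
      linarith
    have h6 := mul_nonneg hl1 (neg_nonneg.2 hs)
    have h7 := mul_pos hl0 (neg_pos.2 hr)
    linarith
  -- The star-shaped part of `{f > 0}` around `x`. Convexity of `f` along rays gives `f ≤ 0` on its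
  -- frontier, so cone comparison applies.
  set V : Set E := {z | ∀ s ∈ Icc (0 : ℝ) 1, 0 < f (s • (z - x))} with hV
  have hVo : IsOpen V := by
    rw [isOpen_iff_mem_nhds]
    intro z hz
    refine isCompact_Icc.eventually_forall_of_forall_eventually fun s hs => ?_
    have hc : Continuous fun q : E × ℝ => f (q.2 • (q.1 - x)) := by fun_prop
    exact hc.continuousAt.eventually_const_lt (hz s hs)
  have hVball : V ⊆ Metric.closedBall x R := by
    intro z hz
    refine Metric.closedBall_subset_closedBall htR (mem_closedBall_iff_norm.2 ?_)
    by_contra! hlt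
    have hzx : z - x ≠ 0 := by
      intro h
      rw [h, norm_zero] at hlt
      have : 0 ≤ 2 * t * J := by positivity
      linarith
    obtain ⟨r, hr0, hr1, hr2⟩ := hdip _ hzx
    have hr3 : r ≤ 1 := by
      by_contra! h
      have := norm_nonneg (z - x)
      nlinarith
    exact absurd (hz r ⟨hr0.le, hr3⟩) (not_lt.2 hr2.le)
  have hVcl : closure V ⊆ Metric.closedBall x R :=
    closure_minimal hVball Metric.isClosed_closedBall
  have hVnonneg : ∀ z ∈ closure V, ∀ s ∈ Icc (0 : ℝ) 1, 0 ≤ f (s • (z - x)) := by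
    intro z hz s hs
    exact closure_minimal (t := {z | 0 ≤ f (s • (z - x))}) (fun z hz => (hz s hs).le)
      (isClosed_le continuous_const (by fun_prop)) hz
  have hcomp := hu V x k hk0 hVo
    ((isCompact_closedBall x R).of_isClosed_subset isClosed_closure hVcl) (hVcl.trans hball) (by
    intro z hz
    have hzV : z ∉ V := by
      have := hz.2
      rwa [hVo.interior_eq] at this
    have hnn := hVnonneg z hz.1
    have hfz : f (z - x) ≤ 0 := by
      simp only [hV, mem_ofPred_eq, not_forall, not_lt] at hzV
      obtain ⟨s, hs, hfs⟩ := hzV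
      rcases hs.2.eq_or_lt with rfl | hs1
      · simpa using hfs
      have hzx : z - x ≠ 0 := by
        intro h
        rw [h, smul_zero] at hfs
        linarith
      obtain ⟨r, hr0, -, hr⟩ := hdip _ hzx
      have hr1 : 1 < r := by
        by_contra! h
        exact absurd (hnn r ⟨hr0.le, h⟩) (not_le.2 hr)
      exact (hconv _ s r hs.1 hs1 hr1 hfs hr).le
    have h1 := hle z (hVcl hz.1)
    have h2 : 2 * t * k₀ ≤ 2 * t * k' := by gcongr
    simp only [hf, stepCost] at hfz h1
    linarith)
  by_cases hyV : y ∈ V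
  · have h1 := hcomp y hyV
    have h2 := hH.cone_sub_le_stepCost hk0 hkJ.le ht x y
    have h3 : 0 ≤ t * (k - k₀) := mul_nonneg ht.le (by linarith)
    linarith
  -- Outside `V` the ray has met `{f ≤ 0}`, so the doubling property of the Lagrangian replaces the
  -- cone.
  · simp only [hV, mem_ofPred_eq, not_forall, not_lt] at hyV
    obtain ⟨s, hs, hfs⟩ := hyV
    set q := (2 * t)⁻¹ • (y - x) with hq
    have hyq : y - x = (2 * t) • q := by
      rw [hq, smul_inv_smul₀ (by positivity)]
    have h1 : lag H J (s • q) ≤ s * cone H k q - k' := by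
      simp only [hf] at hfs
      rw [hH.cone_smul hk0 hs.1, hyq, hH.cone_smul hk0 (by positivity), smul_comm s,
        inv_smul_smul₀ (by positivity)] at hfs
      have : 2 * t * lag H J (s • q) ≤ 2 * t * (s * cone H k q - k') := by linarith
      exact le_of_mul_le_mul_left this (by positivity)
    have h2 := mul_le_mul_of_nonneg_left
      (hH.two_mul_lag_add_le hk0 hkJ.le hs.1 hs.2 h1) ht.le
    have h3 : (2 : ℝ) • q = t⁻¹ • (y - x) := by
      rw [hq, smul_smul]
      congr 1
      field_simp
    rw [h3] at h2
    have h4 := hle y hy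
    have h5 : t * k₀ ≤ t * k' := by gcongr
    have h6 : t * k₀ ≤ t * k := by gcongr
    simp only [stepCost, ← hq] at h4 ⊢
    linarith

/-- The convexity criterion: the sup-convolutions of `u` at the times `0`, `t`, `2 t` are
convex. -/
theorem ConeComparison.exists_two_mul_sub_stepCost_le (hH : PosConvex H)
    (huU : ContinuousOn u U) (hu : ConeComparison H u U) {x : E} {ρ k : ℝ} (hρ : 0 < ρ)
    (hk : 0 ≤ k) (hkJ : k + 1 < J) (hJ : ∀ z, cone H (k + 1) z + ‖z‖ ≤ cone H J z) (ht : 0 < t)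
    (htρ : 2 * t * J ≤ ρ) (hball : Metric.closedBall x (2 * ρ) ⊆ U)
    (hle : ∀ y ∈ Metric.closedBall x (2 * ρ), u y ≤ u x + cone H k (y - x)) :
    ∃ w ∈ Metric.closedBall x ρ,
      (∀ w' ∈ Metric.closedBall x (2 * ρ),
        u w' - stepCost H J (2 * t) x w' ≤ u w - stepCost H J (2 * t) x w) ∧
      ∀ y ∈ Metric.closedBall x ρ,
        2 * (u y - stepCost H J t x y) ≤ u w - stepCost H J (2 * t) x w + u x := by
  have := FiniteDimensional.proper_real E
  have hJ0 : 0 ≤ J := by linarith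
  have ht2 : 0 < 2 * t := by positivity
  have hxB : x ∈ Metric.closedBall x (2 * ρ) := Metric.mem_closedBall_self (by positivity)
  obtain ⟨w, hw, hmax⟩ := (isCompact_closedBall x (2 * ρ)).exists_isMaxOn ⟨x, hxB⟩
    ((huU.mono hball).sub (hH.continuous_stepCost (t := 2 * t) hJ0 x).continuousOn)
  have hmax' : ∀ w' ∈ Metric.closedBall x (2 * ρ),
      u w' - stepCost H J (2 * t) x w' ≤ u w - stepCost H J (2 * t) x w := fun w' h => hmax h
  have h1 := hmax' x hxB
  rw [hH.stepCost_self hJ0, sub_zero] at h1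
  have h2 := hle w hw
  -- The cost exceeds the growth of `u` by `‖w - x‖ - 2 * t * J`, so a maximizer cannot be far away.
  have hwρ : w ∈ Metric.closedBall x ρ := by
    have h3 := hH.cone_sub_le_stepCost hJ0 le_rfl ht2 x w
    have h4 := hJ (w - x)
    have h5 := hH.cone_mono hk (by linarith : k ≤ k + 1) (w - x)
    rw [mem_closedBall_iff_norm]
    linarith
  refine ⟨w, hwρ, hmax', fun y hy => ?_⟩
  set a := u w - stepCost H J (2 * t) x w with ha
  -- With this slope the previous bound `u x + t * k₀` is the mean of `a` and `u x`; the error `κ`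
  -- tends to zero.
  set k₀ := (a - u x) / (2 * t) with hk₀
  have hak : a = u x + 2 * t * k₀ := by
    rw [hk₀]
    field_simp
    ring
  have hk₀0 : 0 ≤ k₀ := div_nonneg (by linarith) ht2.le
  have hk₀k : k₀ ≤ k := by
    have h3 := hH.cone_sub_le_stepCost hk (by linarith : k ≤ J) ht2 x w
    rw [hk₀, div_le_iff₀ ht2]
    linarith
  have hyB : y ∈ Metric.closedBall x (2 * ρ) :=
    Metric.closedBall_subset_closedBall (by linarith) hy
  refine le_of_forall_pos_le_add fun ε hε => ?_
  set κ := min 1 (ε / (4 * t)) with hκ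
  have hκ0 : 0 < κ := lt_min one_pos (by positivity)
  have hκ1 : κ ≤ 1 := min_le_left _ _
  have hκ2 : 4 * t * κ ≤ ε := by
    have := min_le_right 1 (ε / (4 * t))
    rwa [le_div_iff₀' (by positivity)] at this
  have h3 := hu.sub_stepCost_le_add hH (k := k₀ + κ) (J := J) hk₀0 (by linarith) (by linarith)
    (fun z => (by gcongr; exact hH.cone_mono (by linarith) (by linarith) z :
      cone H (k₀ + κ) z + ‖z‖ ≤ cone H (k + 1) z + ‖z‖).trans (hJ z)) ht
    (by linarith : 2 * t * J ≤ 2 * ρ) hball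
    (fun w' hw' => by have := hmax' w' hw'; linarith) hyB
  linarith

end Slope

/-! ### Sup-convolutions as discrete subsolutions -/

section SupConvolution

variable {E : Type*} [NormedAddCommGroup E] [InnerProductSpace ℝ E] {H u : E → ℝ}

/-- The local sup-convolution of `u`. -/
noncomputable def supConv (H : E → ℝ) (J t ρ : ℝ) (u : E → ℝ) (x : E) : ℝ :=
  sSup ((fun y => u y - stepCost H J t x y) '' Metric.closedBall x ρ)

variable [FiniteDimensional ℝ E] {U : Set E} {J t ρ : ℝ}

theorem PosConvex.exists_eq_supConv (hH : PosConvex H) (hJ : 0 ≤ J) (hρ : 0 ≤ ρ) {x : E}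
    (hu : ContinuousOn u (Metric.closedBall x ρ)) :
    ∃ y ∈ Metric.closedBall x ρ, supConv H J t ρ u x = u y - stepCost H J t x y ∧
      ∀ z ∈ Metric.closedBall x ρ, u z - stepCost H J t x z ≤ supConv H J t ρ u x := by
  have := FiniteDimensional.proper_real E
  obtain ⟨y, hy, h1, h2⟩ := (isCompact_closedBall x ρ).exists_sSup_image_eq_and_ge
    ⟨x, Metric.mem_closedBall_self hρ⟩
    (hu.sub (hH.continuous_stepCost (t := t) hJ x).continuousOn)
  exact ⟨y, hy, h1, fun z hz => (h2 z hz).trans h1.ge⟩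

/-- Bounded functions enjoying comparison with cones are uniformly Lipschitz away from the
boundary. -/
theorem ConeComparison.exists_le_add_cone (hH : PosConvex H) (hu : ConeComparison H u U) {B R : ℝ}
    (hB : ∀ x ∈ U, |u x| ≤ B) (hR : 0 < R) :
    ∃ k, 0 ≤ k ∧ ∀ x, Metric.closedBall x R ⊆ U → ∀ y ∈ Metric.closedBall x R,
      u y ≤ u x + cone H k (y - x) := by
  have := FiniteDimensional.proper_real E
  obtain ⟨k, hk, h⟩ := hH.exists_mul_norm_le_cone (2 * B / R)
  refine ⟨k, hk, fun x hx y hy => ?_⟩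
  have hsphere : ∀ z ∈ Metric.sphere x R, u z ≤ u x + cone H k (z - x) := by
    intro z hz
    have h1 := h k le_rfl (z - x)
    rw [mem_sphere_iff_norm.1 hz, div_mul_cancel₀ _ hR.ne'] at h1
    have h2 := abs_le.1 (hB z (hx (Metric.sphere_subset_closedBall hz)))
    have h3 := abs_le.1 (hB x (hx (Metric.mem_closedBall_self hR.le)))
    linarith
  rcases (Metric.mem_closedBall.1 hy).lt_or_eq with h1 | h1
  · have hcl : closure (Metric.ball x R) ⊆ Metric.closedBall x R :=
      Metric.closure_ball_subset_closedBall
    exact hu (Metric.ball x R) x k hk Metric.isOpen_ball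
      ((isCompact_closedBall x R).of_isClosed_subset isClosed_closure hcl) (hcl.trans hx)
      (fun z hz => hsphere z (Metric.frontier_ball_subset_sphere hz)) y h1
  · exact hsphere y h1

/-- The sup-convolution of a function enjoying comparison with cones satisfies the discrete
subsolution property. -/
theorem ConeComparison.discreteSub (hH : PosConvex H) (huU : ContinuousOn u U)
    (hu : ConeComparison H u U) {k : ℝ} (hρ : 0 < ρ) (hk : 0 ≤ k) (hkJ : k + 1 < J)
    (hJ : ∀ z, cone H (k + 1) z + ‖z‖ ≤ cone H J z) (ht : 0 < t) (htρ : 2 * t * J ≤ ρ)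
    {S Y : Set E} {w : E → ℝ} (hw : ∀ x ∈ S, w x = supConv H J t ρ u x)
    (hS : ∀ x ∈ S, Metric.closedBall x (2 * ρ) ⊆ U)
    (hY : ∀ x ∈ Y, Metric.closedBall x ρ ⊆ S)
    (hle : ∀ x, Metric.closedBall x (2 * ρ) ⊆ U → ∀ y ∈ Metric.closedBall x (2 * ρ),
      u y ≤ u x + cone H k (y - x)) :
    DiscreteSub (fun x y => dist x y ≤ ρ) (stepCost H J t) w Y := by
  intro x hx
  have hJ0 : 0 ≤ J := by linarith
  have hxS : x ∈ S := hY x hx (Metric.mem_closedBall_self hρ.le)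
  have hconv : ∀ y ∈ S, ∃ z ∈ Metric.closedBall y ρ, w y = u z - stepCost H J t y z ∧
      ∀ z ∈ Metric.closedBall y ρ, u z - stepCost H J t y z ≤ w y := by
    intro y hy
    rw [hw y hy]
    exact hH.exists_eq_supConv hJ0 hρ.le (huU.mono
      ((Metric.closedBall_subset_closedBall (by linarith)).trans (hS y hy)))
  have hmemS : ∀ y, dist x y ≤ ρ → y ∈ S := fun y hy => hY x hx (by rwa [Metric.mem_closedBall'])
  obtain ⟨a, ha, hmax, ha2⟩ := hu.exists_two_mul_sub_stepCost_le hH huU hρ hk hkJ hJ ht htρ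
    (hS x hxS) (hle x (hS x hxS))
  have hda : dist x a ≤ ρ := by rwa [Metric.mem_closedBall'] at ha
  obtain ⟨hm1, hm2⟩ := stepCost_midpoint (H := H) (J := J) (t := t) x a
  have hxm : dist x (midpoint ℝ x a) ≤ ρ := by
    rw [dist_left_midpoint (𝕜 := ℝ), Real.norm_ofNat]
    linarith [dist_nonneg (x := x) (y := a)]
  have hma : a ∈ Metric.closedBall (midpoint ℝ x a) ρ := by
    rw [Metric.mem_closedBall', dist_midpoint_right (𝕜 := ℝ), Real.norm_ofNat]
    linarith [dist_nonneg (x := x) (y := a)]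
  obtain ⟨-, -, -, hmid⟩ := hconv _ (hmemS _ hxm)
  have hmid' := hmid a hma
  -- The best step goes halfway to the maximizer `a` for time `2 t`, since splitting at the midpoint
  -- does not raise the cost.
  refine ⟨midpoint ℝ x a, hxm, fun y hy => ?_, fun z hz => ?_⟩
  · obtain ⟨b, hb, hyb, -⟩ := hconv y (hmemS y hy)
    have h1 := hH.stepCost_two_mul_le hJ0 ht x y b
    have h2 := hmax b (by
      rw [Metric.mem_closedBall'] at hb ⊢
      linarith [dist_triangle x y b])
    linarith
  · obtain ⟨b, hb, hxb, -⟩ := hconv x hxS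
    have h1 := ha2 b hb
    obtain ⟨-, -, -, hz'⟩ := hconv z (hmemS z (by rwa [dist_comm]))
    have h2 := hz' x (by rwa [Metric.mem_closedBall'])
    linarith

end SupConvolution

/-! ### Comparison on open sets with compact boundary -/

section Exterior

open Filter Topology

/-- The ball is connected and misses the frontier, so it cannot leave the interior of `U`. -/
theorem closedBall_subset_of_lt_infDist_frontier {E : Type*} [NormedAddCommGroup E]
    [NormedSpace ℝ E] {U : Set E} {x : E} {R : ℝ} (hx : x ∈ U) (hR : 0 ≤ R)
    (h : R < Metric.infDist x (frontier U)) : Metric.closedBall x R ⊆ U := by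
  have hfr : ∀ z ∈ Metric.closedBall x R, z ∉ frontier U := fun z hz hzf => by
    have h1 := Metric.infDist_le_dist_of_mem (x := x) hzf
    rw [Metric.mem_closedBall'] at hz
    linarith
  have hint : ∀ z ∈ Metric.closedBall x R, z ∈ closure U → z ∈ interior U := fun z hz hzc => by
    by_contra hzi
    exact hfr z hz ⟨hzc, hzi⟩
  intro y hy
  by_contra hyU
  obtain ⟨z, -, hz1, hz2⟩ := (convex_closedBall x R).isPreconnected (interior U) (closure U)ᶜ
    isOpen_interior isClosed_closure.isOpen_compl
    (fun z hz => (em (z ∈ closure U)).imp (hint z hz) id)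
    ⟨x, Metric.mem_closedBall_self hR, hint x (Metric.mem_closedBall_self hR) (subset_closure hx)⟩
    ⟨y, hy, fun h => hyU (interior_subset (hint y hy h))⟩
  exact hz2 (interior_subset_closure hz1)

/-- Near the compact boundary, `u - v` is nearly bounded by its maximum on the boundary, even with
slightly different arguments. -/
theorem exists_forall_sub_lt {E : Type*} [PseudoMetricSpace E] {U : Set E}
    (hcomp : IsCompact (frontier U)) (hne : (frontier U).Nonempty) {u v : E → ℝ}
    (hu : ContinuousOn u (closure U)) (hv : ContinuousOn v (closure U)) {m g : ℝ}
    (hm : ∀ y ∈ frontier U, u y - v y ≤ m) (hg : 0 < g) :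
    ∃ δ > 0, ∀ y ∈ U, ∀ z ∈ U, Metric.infDist y (frontier U) < δ → dist y z < δ →
      u y - v z < m + g := by
  have hloc : ∀ p ∈ frontier U, ∃ r > 0, ∀ y ∈ U, dist y p < r →
      u y < u p + g / 2 ∧ v p - g / 2 < v y := by
    intro p hp
    have h1 := (hu p hp.1).eventually_lt_const (show u p < u p + g / 2 by linarith)
    have h2 := (hv p hp.1).eventually_const_lt (show v p - g / 2 < v p by linarith)
    obtain ⟨r, hr, h⟩ := Metric.mem_nhdsWithin_iff.1 (h1.and h2)
    exact ⟨r, hr, fun y hy hyp => h ⟨hyp, subset_closure hy⟩⟩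
  choose! r hr h using hloc
  obtain ⟨δ, hδ, hcov⟩ := lebesgue_number_lemma_of_metric (s := frontier U)
    (c := fun p : frontier U => Metric.ball (p : E) (r p)) hcomp
    (fun _ => Metric.isOpen_ball)
    fun p hp => mem_iUnion.2 ⟨⟨p, hp⟩, Metric.mem_ball_self (hr p hp)⟩
  refine ⟨δ / 2, by positivity, fun y hy z hz hyF hyz => ?_⟩
  obtain ⟨p, hp, hyp⟩ := (Metric.infDist_lt_iff hne).1 hyF
  obtain ⟨⟨q, hq⟩, hpq⟩ := hcov p hp
  have h1 : dist y q < r q := hpq (Metric.mem_ball.2 (by linarith))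
  have h2 : dist z q < r q := hpq (Metric.mem_ball.2 (by
    linarith [dist_triangle z y p, dist_comm y z]))
  have h3 := (h q hq y hy h1).1
  have h4 := (h q hq z hz h2).2
  have h5 := hm q hq
  linarith

variable {n : ℕ} {H u v : EuclideanSpace ℝ (Fin n) → ℝ} {U : Set (EuclideanSpace ℝ (Fin n))}

theorem IsHamiltonian.posConvex (hH : IsHamiltonian H) (hH0 : H ⁻¹' {0} = {0}) :
    PosConvex H where
  convex := hH.convex
  map_zero := hH.map_zero
  pos p hp := (hH.nonneg p).lt_of_ne' fun h => hp (by
    have : p ∈ H ⁻¹' {0} := h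
    rwa [hH0] at this)

theorem supHD_comp_neg (V : Set (EuclideanSpace ℝ (Fin n))) :
    supHD (fun p => H (-p)) (fun x => -v x) V = supHD H v V := by
  have : ∀ x, gradient (fun x => -v x) x = -gradient v x := fun x => by
    simp [gradient, fderiv_fun_neg]
  simp only [supHD, this, neg_neg]

theorem LipLoc.neg (hv : LipLoc v U) : LipLoc (fun x => -v x) U := fun V hV =>
  let ⟨K, hK⟩ := hv V hV
  ⟨K, fun x hx y hy => by simpa [edist_neg_neg] using hK hx hy⟩

theorem AbsSuperminimizing.neg (hv : AbsSuperminimizing H v U) :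
    AbsSubminimizing (fun p => H (-p)) (fun x => -v x) U := by
  refine ⟨hv.1.neg, fun V w hV hw hwc hfr hle => ?_⟩
  have h := hv.2 V (fun x => -w x) hV hw.neg hwc.neg (fun x hx => by rw [hfr x hx, neg_neg])
    fun x hx => by linarith [hle x hx]
  have hw' : supHD (fun p => H (-p)) w V = supHD H (fun x => -w x) V := by
    rw [← supHD_comp_neg]
    simp only [neg_neg]
  rwa [supHD_comp_neg, hw']

/-- Reflecting `H` reverses steps, which turns the subsolution property of the transform of `-v`
into the supersolution property with the original cost. -/
theorem stepCost_comp_neg (J t : ℝ) (x y : EuclideanSpace ℝ (Fin n)) :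
    stepCost (fun p => H (-p)) J t x y = stepCost H J t y x := by
  rw [stepCost, stepCost, PosConvex.lag_comp_neg, ← smul_neg, neg_sub]

/-- Points are joined by short steps with small cost. -/
theorem PosConvex.exists_chain {E : Type*} [NormedAddCommGroup E] [InnerProductSpace ℝ E]
    [FiniteDimensional ℝ E] {H : E → ℝ} (hH : PosConvex H) {J t ρ η : ℝ} (hJ : 0 ≤ J)
    (ht : 0 < t) (hρ : 0 < ρ) (hη : 0 < η) (x p : E) :
    ∃ (k : ℕ) (γ : ℕ → E), γ 0 = x ∧ γ k = p ∧
      (∀ i < k, dist (γ i) (γ (i + 1)) ≤ ρ ∧ dist (γ (i + 1)) (γ i) ≤ ρ) ∧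
      ∑ i ∈ Finset.range k, (stepCost H J t (γ i) (γ (i + 1)) +
        stepCost H J t (γ (i + 1)) (γ i)) ≤ η := by
  -- Each step costs `t` times the Lagrangian, so each of the two directions receives the budget `η
  -- / 2`.
  have hη' : 0 < η / (2 * t) := by positivity
  obtain ⟨k, h1, h2, h3, h4⟩ := ((hH.eventually_mul_lag_le hJ (t⁻¹ • (p - x)) hη').and
    ((hH.eventually_mul_lag_le hJ (-(t⁻¹ • (p - x))) hη').and
    ((eventually_ge_atTop ⌈‖p - x‖ / ρ⌉₊).and (eventually_ge_atTop 1)))).exists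
  have hk : (0 : ℝ) < k := by exact_mod_cast h4
  have hkρ : ‖p - x‖ ≤ ρ * k := by
    have := Nat.ceil_le.1 h3
    rwa [div_le_iff₀' hρ] at this
  set γ : ℕ → E := fun i => x + ((i : ℝ) * (k : ℝ)⁻¹) • (p - x) with hγ
  have hdiff : ∀ i, γ (i + 1) - γ i = (k : ℝ)⁻¹ • (p - x) := by
    intro i
    simp only [hγ, Nat.cast_add, Nat.cast_one]
    module
  have hdist : ∀ i, dist (γ (i + 1)) (γ i) ≤ ρ := by
    intro i
    rw [dist_eq_norm, hdiff, norm_smul, norm_inv, Real.norm_natCast, inv_mul_le_iff₀ hk]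
    linarith
  refine ⟨k, γ, by simp [hγ], by simp [hγ, mul_inv_cancel₀ hk.ne'],
    fun i _ => ⟨by rw [dist_comm]; exact hdist i, hdist i⟩, ?_⟩
  have hcost : ∀ i, stepCost H J t (γ i) (γ (i + 1)) + stepCost H J t (γ (i + 1)) (γ i) =
      t * (lag H J ((k : ℝ)⁻¹ • t⁻¹ • (p - x)) + lag H J ((k : ℝ)⁻¹ • -(t⁻¹ • (p - x)))) := by
    intro i
    have h5 : γ i - γ (i + 1) = -((k : ℝ)⁻¹ • (p - x)) := by rw [← hdiff i, neg_sub]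
    rw [stepCost, stepCost, hdiff, h5, smul_neg, smul_neg, smul_comm t⁻¹, mul_add]
  rw [Finset.sum_congr rfl fun i _ => hcost i, Finset.sum_const, Finset.card_range, nsmul_eq_mul]
  calc _ = t * (k * lag H J ((k : ℝ)⁻¹ • t⁻¹ • (p - x)) +
        k * lag H J ((k : ℝ)⁻¹ • -(t⁻¹ • (p - x)))) := by ring
    _ ≤ t * (η / (2 * t) + η / (2 * t)) := by gcongr
    _ = η := by field_simp; ring

/-- The comparison principle on open sets with compact boundary. -/
theorem sub_le_of_forall_frontier (hH : PosConvex H) (hU : IsOpen U)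
    (hne : (frontier U).Nonempty) (hcomp : IsCompact (frontier U))
    (hu_cont : ContinuousOn u (closure U)) (hv_cont : ContinuousOn v (closure U)) {B : ℝ}
    (huB : ∀ x ∈ closure U, |u x| ≤ B) (hvB : ∀ x ∈ closure U, |v x| ≤ B)
    (hu : AbsSubminimizing H u U) (hv : AbsSuperminimizing H v U) {m : ℝ}
    (hm : ∀ y ∈ frontier U, u y - v y ≤ m) {x : EuclideanSpace ℝ (Fin n)} (hx : x ∈ U) :
    u x - v x ≤ m := by
  classical
  by_contra! hlt
  obtain ⟨p, hp⟩ := hne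
  have hpU : p ∉ U := by
    have := hp.2
    rwa [hU.interior_eq] at this
  have hB0 : 0 ≤ B := (abs_nonneg _).trans (huB p hp.1)
  have hmB : -(2 * B) ≤ m := by
    have h1 := hm p hp
    have h2 := abs_le.1 (huB p hp.1)
    have h3 := abs_le.1 (hvB p hp.1)
    linarith
  set g := (u x - v x - m) / 2 with hg
  have hg0 : 0 < g := by
    rw [hg]
    linarith
  obtain ⟨δ, hδ, hnear⟩ := exists_forall_sub_lt hcomp ⟨p, hp⟩ hu_cont hv_cont hm hg0
  have hxδ : δ ≤ Metric.infDist x (frontier U) := by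
    by_contra! h
    have := hnear x hx x hx h (by simpa using hδ)
    linarith
  -- Maximizers for a point at distance at most `3 * ρ` lie within `4 * ρ` of the frontier and `2 *
  -- ρ` of each other, both below `δ`.
  set ρ := δ / 5 with hρ
  have hρ0 : 0 < ρ := by positivity
  set H' : EuclideanSpace ℝ (Fin n) → ℝ := fun p => H (-p) with hH'def
  have hH' : PosConvex H' := hH.comp_neg
  have huU : ContinuousOn u U := hu_cont.mono subset_closure
  have hvU : ContinuousOn (fun x => -v x) U := (hv_cont.mono subset_closure).neg
  have hcu : ConeComparison H u U := hu.coneComparison hH hU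
  have hcv : ConeComparison H' (fun x => -v x) U := hv.neg.coneComparison hH' hU
  obtain ⟨k₁, hk₁, hk₁u⟩ := hcu.exists_le_add_cone hH (B := B) (R := 2 * ρ)
    (fun y hy => huB y (subset_closure hy)) (by positivity)
  obtain ⟨k₂, hk₂, hk₂v⟩ := hcv.exists_le_add_cone hH' (B := B) (R := 2 * ρ)
    (fun y hy => by rw [abs_neg]; exact hvB y (subset_closure hy)) (by positivity)
  obtain ⟨J₁, hJ₁, hJ₁c⟩ := hH.exists_cone_add_norm_le (k := k₁ + 1) (by linarith)
  obtain ⟨J₂, hJ₂, hJ₂c⟩ := hH'.exists_cone_add_norm_le (k := k₂ + 1) (by linarith)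
  set J := max J₁ J₂ + 1 with hJ
  have hJ1 : J₁ < J := by linarith [le_max_left J₁ J₂]
  have hJ2 : J₂ < J := by linarith [le_max_right J₁ J₂]
  have hJ0 : 0 < J := by linarith
  set t := ρ / (2 * J) with ht
  have ht0 : 0 < t := by positivity
  have htρ : 2 * t * J ≤ ρ := by
    rw [ht]
    apply le_of_eq
    field_simp
  set S := {y | y ∈ U ∧ 2 * ρ < Metric.infDist y (frontier U)} with hS
  set Y := {y | y ∈ U ∧ 3 * ρ < Metric.infDist y (frontier U)} with hY
  have hSU : ∀ y ∈ S, Metric.closedBall y (2 * ρ) ⊆ U := fun y hy =>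
    closedBall_subset_of_lt_infDist_frontier hy.1 (by positivity) hy.2
  have hYS : ∀ y ∈ Y, Metric.closedBall y ρ ⊆ S := by
    intro y hy z hz
    have h1 := Metric.infDist_le_infDist_add_dist (s := frontier U) (x := y) (y := z)
    have h2 := Metric.mem_closedBall'.1 hz
    exact ⟨closedBall_subset_of_lt_infDist_frontier hy.1 (by positivity) hy.2
      (Metric.closedBall_subset_closedBall (by linarith) hz), by linarith [hy.2]⟩
  -- The transforms are extended to the whole space; outside `S` the default values make the
  -- difference `-6 * B`, below `m + g`.
  set w := fun y => if y ∈ S then supConv H J t ρ u y else -(3 * B) with hw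
  set w' := fun y => if y ∈ S then supConv H' J t ρ (fun x => -v x) y else -(3 * B) with hw'
  have hwS : ∀ y ∈ S, w y = supConv H J t ρ u y := fun y hy => if_pos hy
  have hwS' : ∀ y ∈ S, w' y = supConv H' J t ρ (fun x => -v x) y := fun y hy => if_pos hy
  have hwn : ∀ y ∉ S, w y = -(3 * B) := fun y hy => if_neg hy
  have hwn' : ∀ y ∉ S, w' y = -(3 * B) := fun y hy => if_neg hy
  have hballU : ∀ y ∈ S, Metric.closedBall y ρ ⊆ U := fun y hy =>
    (Metric.closedBall_subset_closedBall (by linarith)).trans (hSU y hy)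
  have hconv : ∀ y ∈ S, u y ≤ w y ∧ ∃ z ∈ Metric.closedBall y ρ, w y ≤ u z := by
    intro y hy
    obtain ⟨z, hz, h1, h2⟩ := hH.exists_eq_supConv (J := J) (t := t) hJ0.le hρ0.le
      (huU.mono (hballU y hy))
    have h3 := h2 y (Metric.mem_closedBall_self hρ0.le)
    rw [hH.stepCost_self hJ0.le] at h3
    have h4 := hH.stepCost_nonneg hJ0.le ht0.le y z
    rw [hwS y hy]
    exact ⟨by linarith, z, hz, by linarith⟩
  have hconv' : ∀ y ∈ S, -v y ≤ w' y ∧ ∃ z ∈ Metric.closedBall y ρ, w' y ≤ -v z := by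
    intro y hy
    obtain ⟨z, hz, h1, h2⟩ := hH'.exists_eq_supConv (J := J) (t := t) hJ0.le hρ0.le
      (hvU.mono (hballU y hy))
    have h3 := h2 y (Metric.mem_closedBall_self hρ0.le)
    rw [hH'.stepCost_self hJ0.le] at h3
    have h4 := hH'.stepCost_nonneg hJ0.le ht0.le y z
    rw [hwS' y hy]
    exact ⟨by linarith, z, hz, by linarith⟩
  have hsub : DiscreteSub (fun y z => dist y z ≤ ρ) (stepCost H J t) w Y :=
    hcu.discreteSub hH huU hρ0 hk₁ (by linarith) (hJ₁c J hJ1.le) ht0 htρ hwS hSU hYS hk₁u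
  have hsub' : DiscreteSub (fun y z => dist y z ≤ ρ) (stepCost H' J t) w' Y :=
    hcv.discreteSub hH' hvU hρ0 hk₂ (by linarith) (hJ₂c J hJ2.le) ht0 htρ hwS' hSU hYS hk₂v
  have hmain := discrete_comparison (v := fun y => -w' y) (m := m + g) (B := B)
    (hH.stepCost_nonneg hJ0.le ht0.le) hsub ?_ ?_ ?_ ?_ ?_ x
  · have hxS : x ∈ S := ⟨hx, by linarith⟩
    have h1 := (hconv x hxS).1
    have h2 := (hconv' x hxS).1
    linarith
  · intro y hy
    obtain ⟨z, hz, -, h⟩ := hsub' y hy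
    refine ⟨z, by rwa [dist_comm], fun a ha => ?_⟩
    have := h a (by simpa only [dist_comm] using ha)
    rw [stepCost_comp_neg, stepCost_comp_neg] at this
    linarith
  · intro y
    by_cases hy : y ∈ S
    · obtain ⟨-, z, hz, h⟩ := hconv y hy
      exact h.trans (abs_le.1 (huB z (subset_closure (hballU y hy hz)))).2
    · rw [hwn y hy]
      linarith
  · intro y
    by_cases hy : y ∈ S
    · obtain ⟨-, z, hz, h⟩ := hconv' y hy
      linarith [(abs_le.1 (hvB z (subset_closure (hballU y hy hz)))).1]
    · rw [hwn' y hy]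
      linarith
  · intro y hyY
    by_cases hy : y ∈ S
    · obtain ⟨-, a, ha, h⟩ := hconv y hy
      obtain ⟨-, b, hb, h'⟩ := hconv' y hy
      have h1 : Metric.infDist y (frontier U) ≤ 3 * ρ := by
        by_contra! h1
        exact hyY ⟨hy.1, h1⟩
      have h2 := Metric.infDist_le_infDist_add_dist (s := frontier U) (x := a) (y := y)
      rw [Metric.mem_closedBall] at ha hb
      have h3 := hnear a (hballU y hy ha) b (hballU y hy hb) (by linarith)
        (by linarith [dist_triangle_right a b y])
      linarith
    · rw [hwn y hy, hwn' y hy]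
      linarith
  -- Thanks to the extension, straight chains to the boundary point `p` may cross the complement of
  -- `U`.
  · intro y η hη
    obtain ⟨k, γ, h0, h1, h2, h3⟩ := hH.exists_chain hJ0.le ht0 hρ0 hη y p
    exact ⟨k, γ, h0, fun h => hpU (by rw [← h1]; exact h.1), h2, h3⟩

end Exterior

end ExteriorComparison

theorem mainTheorem6 {n : ℕ} (H : EuclideanSpace ℝ (Fin n) → ℝ)
    (hH : ExteriorComparison.IsHamiltonian H) (hH0 : H ⁻¹' {0} = {0})
    (U : Set (EuclideanSpace ℝ (Fin n))) (hU : IsOpen U)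
    (hU_unbounded : ¬ Bornology.IsBounded U)
    (hbd_nonempty : (frontier U).Nonempty) (hbd_compact : IsCompact (frontier U))
    (u v : EuclideanSpace ℝ (Fin n) → ℝ)
    (hu_cont : ContinuousOn u (closure U)) (hv_cont : ContinuousOn v (closure U))
    (hu_bdd : Bornology.IsBounded (u '' closure U))
    (hv_bdd : Bornology.IsBounded (v '' closure U))
    (hu : ExteriorComparison.AbsSubminimizing H u U)
    (hv : ExteriorComparison.AbsSuperminimizing H v U) :
    ∃ M : ℝ, IsGreatest ((fun y => u y - v y) '' frontier U) M ∧
      ∀ x ∈ U, u x - v x ≤ M := by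
  obtain ⟨M, hM⟩ := (hbd_compact.image_of_continuousOn
    ((hu_cont.sub hv_cont).mono frontier_subset_closure)).exists_isGreatest (hbd_nonempty.image _)
  obtain ⟨B₁, hB₁⟩ := hu_bdd.exists_norm_le
  obtain ⟨B₂, hB₂⟩ := hv_bdd.exists_norm_le
  refine ⟨M, hM, fun x hx => ExteriorComparison.sub_le_of_forall_frontier (B := max B₁ B₂)
    (hH.posConvex hH0) hU hbd_nonempty hbd_compact hu_cont hv_cont
    (fun y hy => (hB₁ _ (mem_image_of_mem u hy)).trans (le_max_left _ _))
    (fun y hy => (hB₂ _ (mem_image_of_mem v hy)).trans (le_max_right _ _)) hu hv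
    (fun y hy => hM.2 (mem_image_of_mem _ hy)) hx⟩
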